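/- **Setting.** For each length $N\ge 1$ observe $x(n)=A_1e^{j2\pi f_1n}+A_2e^{j2\pi f_2n}+w(n)$, $n=0,\dots,N-1$, where $A_1,A_2\in\mathbb C$, $A_1\ne 0$, and the $w(n)$ are i.i.d. circular complex Gaussian with mean $0$ and variance $\sigma^2>0$. Write $\rho_1=|A_1|^2/\sigma^2$ and $f_l=(m_l+\delta_l)/N$ with $m_l\in\mathbb Z$, $\delta_l\in[-\tfrac12,\tfrac12]$; $m_l,\delta_l,f_l$ may depend on $N$. *Assumption 1:* there is $\Delta>0$, independent of $N$, such that the distance of $f_1$ and $f_2$ modulo $1$ is at least $\Delta$. Put $M=m_2-m_1$. **Estimator.** Let $\nu_1,\nu_2\in[-\tfrac12,\tfrac12]$ (they may depend on $N$) be given estimates of $\delta_1,\delta_2$, and let $\hat A_1$ be an estimate of $A_1$, possibly random, with $\sup_N E|\hat A_1|^3<\infty$. Put $g_l=(m_l+\nu_l)/N$ and, for a sequence $y$, $F_y(f)=\frac1N\sum_{n=0}^{N-1}y(n)e^{-j2\pi fn}$. Set $\hat A_2=F_{y}(g_2)$ with $y(n)=x(n)-\hat A_1e^{j2\pi g_1n}$,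 $\hat S_\pm=F_{y'}\big(g_1\pm\tfrac1{2N}\big)$ with $y'(n)=x(n)-\hat A_2e^{j2\pi g_2n}$, $\hat h=\frac12\frac{\hat S_++\hat S_-}{\hat S_+-\hat S_-}$, and $$\hat f_1=\frac1N\Big(m_1+\nu_1-\frac N{2\pi}\,\Im\ln\big(\cos\tfrac\pi N-2j\hat h\sin\tfrac\pi N\big)\Big).$$ **Claim.** Let $d=\delta_1-\nu_1$, let $\kappa(d)=\frac{d^2-1/4}{\cos(\pi d)}$ (with its limit value $-1/\pi$ at $d=\pm\frac12$), and $$\beta_\pm=\frac{1+e^{j2\pi(\delta_2-\nu_1)}}{1-e^{j\frac{2\pi}N(M+\delta_2-\nu_1\mp 1/2)}}-\frac{\big(1-e^{j2\pi(\delta_2-\nu_2)}\big)\big(1+e^{j2\pi(\nu_2-\nu_1)}\big)}{N\big(1-e^{j\frac{2\pi}N(\delta_2-\nu_2)}\big)\big(1-e^{j\frac{2\pi}N(M+\nu_2-\nu_1\mp 1/2)}\big)},$$ where $\frac{1-e^{j2\pi t}}{N(1-e^{j2\pi t/N})}$ is read as $1$ at $t=0$. Put $$\mu_{f_1}=\frac{\pi\,\kappa(d)}{2N^2}\Big\{(1-2d)\,\Im\Big[e^{-j\pi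 d}\tfrac{A_2}{A_1}\beta_+\Big]+(1+2d)\,\Im\Big[e^{-j\pi d}\tfrac{A_2}{A_1}\beta_-\Big]\Big\},$$ $$\sigma^2_{f_1}=\frac{\pi^2\kappa(d)^2(1+4d^2)}{4\rho_1N^3}=\frac{\pi^2\big[(\delta_1-\nu_1)^2-\frac14\big]^2\big[1+4(\delta_1-\nu_1)^2\big]}{4\rho_1N^3\cos^2(\pi(\delta_1-\nu_1))}.$$ Then, as $N\to\infty$, $\hat f_1$ is asymptotically $\mathcal N(f_1+\mu_{f_1},\sigma_{f_1}^2)$, that is, $(\hat f_1-f_1-\mu_{f_1})/\sigma_{f_1}$ converges in distribution to $\mathcal N(0,1)$; moreover $\hat f_1$ is integrable and $E\hat f_1=f_1+\mu_{f_1}+o(N^{-2})$. Finally $\mu_{f_1}=0$ whenever $\nu_1=\delta_1$ and $\nu_2=\delta_2$. -/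

import Mathlib

noncomputable section

namespace FreqEst

open MeasureTheory ProbabilityTheory

/-- The complex exponential `e^{j2πt}`. -/
def osc (t : ℝ) : ℂ := Complex.exp (2 * Real.pi * t * Complex.I)

/-- The exponential `n ↦ A e^{j2πfn}` with complex amplitude `A` and normalised frequency `f`. -/
def tone (A : ℂ) (f : ℝ) (n : ℕ) : ℂ := A * osc (f * n)

/-- The Fourier coefficient `(1/N) ∑_{n=0}^{N-1} x(n) e^{-j2πfn}` at normalised frequency `f`. -/
def fourierCoeff (N : ℕ) (x : ℕ → ℂ) (f : ℝ) : ℂ :=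
  (1 / (N : ℂ)) * ∑ n ∈ Finset.range N, x n * osc (-(f * n))

/-- The frequency `(m + δ) / N` with bin `m` and residual `δ`. -/
def freq (N : ℕ) (m : ℤ) (δ : ℝ) : ℝ := (m + δ) / N

/-- Two superimposed exponentials in additive noise `w`. -/
def signal (A₁ A₂ : ℂ) (f₁ f₂ : ℝ) (w : ℕ → ℂ) (n : ℕ) : ℂ :=
  tone A₁ f₁ n + tone A₂ f₂ n + w n

/-- The noise: the real and imaginary parts of all the `w n` are jointly independent centred
Gaussian variables of variance `σ² / 2`, so the `w n` are i.i.d. circular complex Gaussian variables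
with mean zero and `E|w n|² = σ²`. -/
structure IsComplexWhiteGaussian {Ω : Type*} [MeasurableSpace Ω] (P : Measure Ω)
    (w : ℕ → Ω → ℂ) (σ : ℝ) : Prop where
  measurable : ∀ n, Measurable (w n)
  indep : iIndepFun
    (fun (i : ℕ × Bool) ω => if i.2 then (w i.1 ω).re else (w i.1 ω).im) P
  map_re : ∀ n, P.map (fun ω => (w n ω).re) = gaussianReal 0 (Real.toNNReal (σ ^ 2 / 2))
  map_im : ∀ n, P.map (fun ω => (w n ω).im) = gaussianReal 0 (Real.toNNReal (σ ^ 2 / 2))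

/-- Estimate of the complex amplitude at frequency `g`, from the data `x` after removal of the
current estimate `B e^{j2πg'n}` of the other component. -/
def ampEst (N : ℕ) (x : ℕ → ℂ) (g : ℝ) (B : ℂ) (g' : ℝ) : ℂ :=
  fourierCoeff N (fun n => x n - tone B g' n) g

/-- The "leakage-free" Fourier coefficient at `g + r / N` (used with `r = ± 1/2`): the coefficient
of the data minus the leakage of the estimate `B e^{j2πg'n}` of the other component. -/
def leakageFreeCoeff (N : ℕ) (x : ℕ → ℂ) (g : ℝ) (B : ℂ) (g' : ℝ) (r : ℝ) : ℂ :=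
  fourierCoeff N x (g + r / N) - fourierCoeff N (tone B g') (g + r / N)

/-- The interpolation function `h` of two Fourier coefficients. -/
def interp (Sp Sm : ℂ) : ℂ := (1 / 2) * ((Sp + Sm) / (Sp - Sm))

/-- The A&M residual estimate `-(N/2π) Im ln (cos(π/N) - 2jh sin(π/N))`. -/
def residualEst (N : ℕ) (Sp Sm : ℂ) : ℝ :=
  -(N / (2 * Real.pi)) *
    (Complex.log ((Real.cos (Real.pi / N) : ℂ)
      - 2 * Complex.I * interp Sp Sm * (Real.sin (Real.pi / N) : ℂ))).im

/-- The update of the estimate of the first frequency from the data `x`, the bins `m₁, m₂`, the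
current residual estimates `ν₁, ν₂`, and the current estimate `B₁` of the first amplitude. -/
def freqEst (N : ℕ) (x : ℕ → ℂ) (m₁ m₂ : ℤ) (ν₁ ν₂ : ℝ) (B₁ : ℂ) : ℝ :=
  let g₁ := freq N m₁ ν₁
  let g₂ := freq N m₂ ν₂
  let B₂ := ampEst N x g₂ B₁ g₁
  freq N m₁ (ν₁ + residualEst N
    (leakageFreeCoeff N x g₁ B₂ g₂ (1 / 2)) (leakageFreeCoeff N x g₁ B₂ g₂ (-(1 / 2))))

/-- `(1 - e^{j2πx}) / (N (1 - e^{j2πx/N}))`, with its limit value `1` at `x = 0`. -/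
def gain (N : ℕ) (x : ℝ) : ℂ :=
  if x = 0 then 1 else (1 - osc x) / (N * (1 - osc (x / N)))

/-- The leakage residual `β_±`, where `r = ± 1/2`. -/
def beta (N : ℕ) (M : ℤ) (δ₂ ν₁ ν₂ r : ℝ) : ℂ :=
  (1 + osc (δ₂ - ν₁)) / (1 - osc ((M + δ₂ - ν₁ - r) / N))
    - gain N (δ₂ - ν₂) * ((1 + osc (ν₂ - ν₁)) / (1 - osc ((M + ν₂ - ν₁ - r) / N)))

/-- `(d² - 1/4) / cos(πd)`, with its limit value `-1/π` at `d = ± 1/2`. -/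
def kappa (d : ℝ) : ℝ :=
  if d = 1 / 2 ∨ d = -(1 / 2) then -(1 / Real.pi)
  else (d ^ 2 - 1 / 4) / Real.cos (Real.pi * d)

/-- The asymptotic bias of the estimate of the first frequency, with `M = m₂ - m₁`. -/
def bias (N : ℕ) (A₁ A₂ : ℂ) (M : ℤ) (δ₁ δ₂ ν₁ ν₂ : ℝ) : ℝ :=
  Real.pi * kappa (δ₁ - ν₁) / (2 * N ^ 2) *
    ((1 - 2 * (δ₁ - ν₁)) * (osc (-(δ₁ - ν₁) / 2) * (A₂ / A₁) * beta N M δ₂ ν₁ ν₂ (1 / 2)).im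
      + (1 + 2 * (δ₁ - ν₁)) *
        (osc (-(δ₁ - ν₁) / 2) * (A₂ / A₁) * beta N M δ₂ ν₁ ν₂ (-(1 / 2))).im)

/-- The asymptotic variance of the estimate of the first frequency, with `ρ₁` the SNR. -/
def asympVar (N : ℕ) (ρ₁ δ₁ ν₁ : ℝ) : ℝ :=
  Real.pi ^ 2 * kappa (δ₁ - ν₁) ^ 2 * (1 + 4 * (δ₁ - ν₁) ^ 2) / (4 * ρ₁ * N ^ 3)

end FreqEst

end

noncomputable section

namespace FreqEst

open MeasureTheory ProbabilityTheory Filter Asymptotics Topology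

/-! ### The complex exponential -/

/-! Without noise or leakage the interpolator is exact: for a pure exponential the coefficients `a`,
`b` at the two half-bin offsets satisfy (1 - e^{j2π(d-1/2)/N}) a = (1 - e^{j2π(d+1/2)/N}) b, and
this turns the argument of the logarithm into e^{-j2πd/N}. With perturbed coefficients the argument
is e^{-j2πd/N}(1 + γ), where γ is an explicit rational function of the perturbations
(`residualEst_perturbed`). The frequency error is therefore -(1/2π) Im ln(1 + γ).

Each perturbation is W + A₂β/N + η, with W a Fourier coefficient of the noise, of order N^{-1/2}
(`leakageFreeCoeff_decomposition`). Separation of the frequencies makes every cross gain O(1/N), so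
the noise and the first-amplitude estimate that enter through the second amplitude only reach the
higher-order term η. With q = N^{-1/2}, the expansion of ln(1 + γ) consists of a term linear in W of
order q³, a deterministic term of order q⁴ that is the bias (`bias_eq`), a quadratic form in W, also
of order q⁴, and a remainder O(q⁵S³), where S is `noiseSize`. If the perturbation is too large to
expand, q²S is bounded below, and the a priori bound on the estimator yields the same remainder
(`log_remainder_isBigO`). Hence no event is discarded, and `freqEst_expansion` may be integrated.

The linear term is exactly Gaussian with the claimed variance, because the two coefficients lie 1/N
apart and their exponentials are orthogonal (`IsComplexWhiteGaussian.map_linTerm`). The quadratic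
term is as large as the bias but has mean zero, because the noise is circular
(`IsComplexWhiteGaussian.integral_im_mul`). The third moment of S is bounded uniformly in N
(`IsComplexWhiteGaussian.integral_noiseSize_le`). So the mean is off by O(q⁵) = o(N⁻²). The standard
deviation is at least a constant times q³ (`rate_cube_le_sqrt_asympVar`), so after normalisation all
that accompanies the linear term is O(q) in L¹ and Slutsky's theorem applies. -/

lemma osc_eq (t : ℝ) : osc t = Complex.exp (Complex.I * ((2 * Real.pi * t : ℝ) : ℂ)) := by
  unfold osc; congr 1; push_cast; ring

@[simp] lemma osc_zero : osc 0 = 1 := by simp [osc]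

lemma osc_add (s t : ℝ) : osc (s + t) = osc s * osc t := by
  simp only [osc, ← Complex.exp_add]; congr 1; push_cast; ring

@[simp] lemma norm_osc (t : ℝ) : ‖osc t‖ = 1 := by
  rw [osc_eq, Complex.norm_exp]; simp

lemma osc_ne_zero (t : ℝ) : osc t ≠ 0 := Complex.exp_ne_zero _

lemma osc_neg (t : ℝ) : osc (-t) = (osc t)⁻¹ := by
  refine eq_inv_of_mul_eq_one_left ?_
  rw [← osc_add]; simp

lemma osc_sub (s t : ℝ) : osc (s - t) = osc s * osc (-t) := by
  rw [sub_eq_add_neg, osc_add]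

lemma osc_mul_osc_neg (t : ℝ) : osc t * osc (-t) = 1 := by
  rw [← osc_add]; simp

@[simp] lemma osc_intCast (k : ℤ) : osc k = 1 := by
  rw [osc, Complex.exp_eq_one_iff]; exact ⟨k, by push_cast; ring⟩

@[simp] lemma osc_half : osc (1 / 2) = -1 := by
  rw [osc, ← Complex.exp_pi_mul_I]; congr 1; push_cast; ring

@[simp] lemma osc_neg_half : osc (-(1 / 2)) = -1 := by
  rw [osc_neg, osc_half]; norm_num

lemma osc_mul_natCast (t : ℝ) (n : ℕ) : osc (t * n) = osc t ^ n := by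
  rw [osc, osc, ← Complex.exp_nat_mul]; congr 1; push_cast; ring

lemma norm_one_sub_osc (t : ℝ) : ‖1 - osc t‖ = 2 * |Real.sin (Real.pi * t)| := by
  rw [norm_sub_rev, osc_eq, Complex.norm_exp_I_mul_ofReal_sub_one, Real.norm_eq_abs, abs_mul,
    abs_two]
  congr 3; ring

lemma norm_one_sub_osc_le (t : ℝ) : ‖1 - osc t‖ ≤ 2 * Real.pi * |t| := by
  rw [norm_sub_rev, osc_eq]
  refine Real.norm_exp_I_mul_ofReal_sub_one_le.trans ?_
  rw [Real.norm_eq_abs, abs_mul, abs_of_pos (by positivity)]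

lemma two_mul_abs_le_abs_sin {t : ℝ} (ht : |t| ≤ 1 / 2) : 2 * |t| ≤ |Real.sin (Real.pi * t)| := by
  have h := Real.mul_le_sin (x := Real.pi * |t|) (by positivity) (by nlinarith [Real.pi_pos])
  have h2 : |Real.sin (Real.pi * t)| = |Real.sin (Real.pi * |t|)| := by
    rcases abs_choice t with h | h <;> rw [h]
    rw [mul_neg, Real.sin_neg, abs_neg]
  rw [h2]
  refine le_trans (le_of_eq ?_) (h.trans (le_abs_self _))
  have := Real.pi_pos.ne'
  field_simp

lemma four_mul_abs_le_norm_one_sub_osc {t : ℝ} (ht : |t| ≤ 1 / 2) : 4 * |t| ≤ ‖1 - osc t‖ := by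
  rw [norm_one_sub_osc]; linarith [two_mul_abs_le_abs_sin ht]

/-- The chord `|1 - e^{j2πt}|` controls the distance of `t` to the integers. -/
lemma four_mul_le_norm_one_sub_osc {t η : ℝ} (h : ∀ k : ℤ, η ≤ |t - k|) :
    4 * η ≤ ‖1 - osc t‖ := by
  have h1 : osc t = osc (t - round t) := by
    rw [osc_sub, osc_neg, osc_intCast]; simp
  rw [h1]
  exact (mul_le_mul_of_nonneg_left (h _) (by norm_num)).trans
    (four_mul_abs_le_norm_one_sub_osc (abs_sub_round t))

lemma osc_ne_one_of_abs_le {t : ℝ} (ht : |t| ≤ 1 / 2) (h0 : t ≠ 0) : osc t ≠ 1 := by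
  intro h
  have := four_mul_abs_le_norm_one_sub_osc ht
  rw [h, sub_self, norm_zero] at this
  have := abs_pos.2 h0
  linarith

lemma norm_osc_sub_one_sub_le {t : ℝ} (ht : 2 * Real.pi * |t| ≤ 1) :
    ‖osc t - 1 - 2 * Real.pi * t * Complex.I‖ ≤ (2 * Real.pi * |t|) ^ 2 := by
  have hn : ‖(2 * Real.pi * t * Complex.I : ℂ)‖ = 2 * Real.pi * |t| := by
    simp [abs_of_pos Real.pi_pos]
  have := Complex.norm_exp_sub_one_sub_id_le (x := 2 * Real.pi * t * Complex.I) (by rw [hn]; exact ht)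
  rwa [hn] at this

/-! ### Fourier coefficients of an exponential -/

lemma gain_mul {N : ℕ} (hN : 1 ≤ N) {x : ℝ} (h : x = 0 ∨ osc (x / N) ≠ 1) :
    gain N x * (N * (1 - osc (x / N))) = 1 - osc x := by
  unfold gain
  have hN0 : (N : ℂ) ≠ 0 := by exact_mod_cast (by omega : N ≠ 0)
  split_ifs with hx
  · simp [hx]
  · have h1 := h.resolve_left hx
    exact div_mul_cancel₀ _ (mul_ne_zero hN0 (sub_ne_zero.2 h1.symm))

lemma gain_mul_of_abs_lt {N : ℕ} (hN : 1 ≤ N) {x : ℝ} (h : |x| ≤ N / 2) :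
    gain N x * (N * (1 - osc (x / N))) = 1 - osc x := by
  refine gain_mul hN ?_
  by_cases hx : x = 0
  · exact Or.inl hx
  · have hN' : (0 : ℝ) < N := by exact_mod_cast hN
    refine Or.inr (osc_ne_one_of_abs_le ?_ (by positivity))
    rw [abs_div, Nat.abs_cast, div_le_iff₀ hN']; linarith

/-- The numerator is at most 2π|x|, while Jordan's inequality bounds N times the chord in the
denominator below by 4|x|. -/
lemma norm_gain_le {N : ℕ} (hN : 1 ≤ N) {x : ℝ} (h : |x| ≤ N / 2) : ‖gain N x‖ ≤ Real.pi / 2 := by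
  by_cases hx : x = 0
  · simp [gain, hx]; linarith [Real.pi_gt_three]
  have hN' : (0 : ℝ) < N := by exact_mod_cast hN
  have h1 := congrArg norm (gain_mul_of_abs_lt hN h)
  have h2 := norm_one_sub_osc_le x
  have h3 := four_mul_abs_le_norm_one_sub_osc (t := x / N)
    (by rw [abs_div, Nat.abs_cast, div_le_iff₀ hN']; linarith)
  rw [norm_mul, norm_mul, Complex.norm_natCast] at h1
  have hx' := abs_pos.2 hx
  have h4 : 4 * |x| ≤ N * ‖1 - osc (x / N)‖ := by
    rw [abs_div, Nat.abs_cast] at h3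
    calc 4 * |x| = N * (4 * (|x| / N)) := by field_simp
      _ ≤ _ := by gcongr
  have h5 : ‖gain N x‖ * (4 * |x|) ≤ 2 * Real.pi * |x| :=
    (mul_le_mul_of_nonneg_left h4 (norm_nonneg _)).trans (h1.le.trans h2)
  nlinarith

lemma norm_gain_le_of_separated {N : ℕ} (hN : 1 ≤ N) {x η : ℝ} (hη : 0 < η) (hη' : η ≤ ‖1 - osc (x / N)‖) :
    ‖gain N x‖ ≤ 2 / η / N := by
  have hN' : (0 : ℝ) < N := by exact_mod_cast hN
  have h1 := congrArg norm (gain_mul hN (x := x) (Or.inr (by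
    intro h; rw [h] at hη'; simp at hη'; linarith)))
  rw [norm_mul, norm_mul, Complex.norm_natCast] at h1
  have h2 : ‖1 - osc x‖ ≤ 2 := (norm_sub_le _ _).trans (by simp; norm_num)
  rw [div_div, le_div_iff₀ (by positivity)]
  calc ‖gain N x‖ * (η * N) ≤ ‖gain N x‖ * (N * ‖1 - osc (x / N)‖) := by
        rw [mul_comm η]; gcongr
    _ ≤ 2 := h1.le.trans h2

lemma fourierCoeff_tone {N : ℕ} (hN : 1 ≤ N) (A : ℂ) {f g x : ℝ} (hx : x / N = f - g)
    (h : x = 0 ∨ osc (x / N) ≠ 1) :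
    fourierCoeff N (tone A f) g = A * gain N x := by
  have hN0 : (N : ℂ) ≠ 0 := by exact_mod_cast (by omega : N ≠ 0)
  have hN1 : (N : ℝ) ≠ 0 := by exact_mod_cast (by omega : N ≠ 0)
  have hs : fourierCoeff N (tone A f) g = A * ((1 / (N : ℂ)) * ∑ n ∈ Finset.range N, osc (x / N) ^ n) := by
    simp only [fourierCoeff, tone, Finset.mul_sum]
    refine Finset.sum_congr rfl fun n _ => ?_
    rw [← osc_mul_natCast, hx, sub_mul, osc_sub]; ring
  rw [hs]
  congr 1
  unfold gain
  split_ifs with h0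
  · simp [h0, hN0]
  · have h1 := h.resolve_left h0
    have h2 : osc x = osc (x / N) ^ N := by
      rw [← osc_mul_natCast]; congr 1; field_simp
    rw [geom_sum_eq h1, h2]
    have := sub_ne_zero.2 h1
    have h3 := sub_ne_zero.2 h1.symm
    field_simp
    ring

lemma fourierCoeff_add (N : ℕ) (x y : ℕ → ℂ) (g : ℝ) :
    fourierCoeff N (fun n => x n + y n) g = fourierCoeff N x g + fourierCoeff N y g := by
  simp only [fourierCoeff, add_mul, Finset.sum_add_distrib, mul_add]

lemma fourierCoeff_sub (N : ℕ) (x y : ℕ → ℂ) (g : ℝ) :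
    fourierCoeff N (fun n => x n - y n) g = fourierCoeff N x g - fourierCoeff N y g := by
  simp only [fourierCoeff, sub_mul, Finset.sum_sub_distrib, mul_sub]

/-- The limit of `gain N x` as `N → ∞`. -/
def limGain (x : ℝ) : ℂ := if x = 0 then 1 else (1 - osc x) / (-(2 * Real.pi * x * Complex.I))

lemma limGain_mul (x : ℝ) : limGain x * (-(2 * Real.pi * x * Complex.I)) = 1 - osc x := by
  unfold limGain
  split_ifs with hx
  · simp [hx]
  · refine div_mul_cancel₀ _ ?_
    have : (x : ℂ) ≠ 0 := by exact_mod_cast hx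
    have : (Real.pi : ℂ) ≠ 0 := by exact_mod_cast Real.pi_ne_zero
    simp [*]

lemma norm_limGain_le (x : ℝ) : ‖limGain x‖ ≤ 1 := by
  unfold limGain
  split_ifs with hx
  · simp
  · rw [norm_div]
    have : ‖(-(2 * Real.pi * x * Complex.I) : ℂ)‖ = 2 * Real.pi * |x| := by
      simp [abs_of_pos Real.pi_pos]
    rw [this]
    exact div_le_one_of_le₀ (norm_one_sub_osc_le x) (by positivity)

/-- Each gain times its own denominator is 1 - e^{j2πx}. The difference is therefore `limGain x`
times the second-order Taylor error of the chord, divided by the chord, which is at least 4|x|/N. -/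
lemma norm_gain_sub_limGain_le {N : ℕ} {x : ℝ} (hN : 20 ≤ N) (hx : |x| ≤ 3 / 2) :
    ‖gain N x - limGain x‖ ≤ 15 / N := by
  have hN' : (0 : ℝ) < N := by exact_mod_cast (by omega : 0 < N)
  have hN20 : (20 : ℝ) ≤ N := by exact_mod_cast hN
  by_cases hx0 : x = 0
  · simp only [gain, limGain, hx0, if_true, sub_self, norm_zero]; positivity
  have hx' := abs_pos.2 hx0
  have habs : |x / N| = |x| / N := by rw [abs_div, Nat.abs_cast]
  have h1 := gain_mul_of_abs_lt (N := N) (by omega) (x := x) (by linarith)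
  have h2 := limGain_mul x
  have h3 := four_mul_abs_le_norm_one_sub_osc (t := x / N)
    (by rw [habs, div_le_iff₀ hN']; linarith)
  have h4 := norm_osc_sub_one_sub_le (t := x / N) (by
    rw [habs, ← mul_div_assoc, div_le_one hN']; nlinarith [Real.pi_lt_four])
  have h5 : (gain N x - limGain x) * (N * (1 - osc (x / N))) =
      limGain x * (N * (osc (x / N) - 1 - 2 * Real.pi * ((x / N : ℝ) : ℂ) * Complex.I)) := by
    have hN0 : (N : ℂ) ≠ 0 := by exact_mod_cast (by omega : N ≠ 0)
    rw [sub_mul, h1, ← h2]; push_cast; field_simp; ring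
  have h6 := congrArg norm h5
  rw [norm_mul, norm_mul, norm_mul, norm_mul, Complex.norm_natCast] at h6
  have h7 : ‖gain N x - limGain x‖ * (N * (4 * (|x| / N))) ≤ 1 * (N * (2 * Real.pi * (|x| / N)) ^ 2) := by
    rw [← habs]
    calc _ ≤ ‖gain N x - limGain x‖ * (N * ‖1 - osc (x / N)‖) := by gcongr
      _ = _ := h6
      _ ≤ _ := by gcongr; exact norm_limGain_le x
  have h8 : ‖gain N x - limGain x‖ * (4 * |x|) ≤ (Real.pi ^ 2 * |x| / N) * (4 * |x|) := by
    refine le_trans (le_of_eq ?_) (h7.trans (le_of_eq ?_))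
    · field_simp
    · field_simp; ring
  -- The constant 15 covers π²|x| for |x| ≤ 3/2.
  refine (le_of_mul_le_mul_right h8 (by positivity)).trans ?_
  gcongr
  nlinarith [Real.pi_lt_d2, Real.pi_pos]

/-! ### Half-bin identities and the factor κ -/

lemma one_add_osc (d : ℝ) : 1 + osc d = 2 * Real.cos (Real.pi * d) * osc (d / 2) := by
  have h : osc d = osc (d / 2) * osc (d / 2) := by rw [← osc_add]; ring_nf
  have h2 : (2 * Real.cos (Real.pi * d) : ℂ) = osc (d / 2) + osc (-(d / 2)) := by
    have : (2 * Real.cos (Real.pi * d) : ℂ) = 2 * Complex.cos (Real.pi * d) := by push_cast; rfl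
    rw [this, Complex.two_cos, osc, osc]; congr 2 <;> push_cast <;> ring
  rw [h2, add_mul, ← h, mul_comm (osc (-(d / 2))), osc_mul_osc_neg]; ring

lemma osc_sub_half (d : ℝ) : osc (d - 1 / 2) = -osc d := by
  rw [osc_sub, osc_neg_half]; ring

lemma osc_add_half (d : ℝ) : osc (d + 1 / 2) = -osc d := by
  rw [osc_add, osc_half]; ring

lemma osc_quarter : osc (1 / 4) = Complex.I := by
  rw [osc_eq, show 2 * Real.pi * (1 / 4) = Real.pi / 2 by ring]
  rw [mul_comm]; push_cast; exact Complex.exp_pi_div_two_mul_I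

/-- Write cos(πd) = sin(π(1/2 - |d|)), apply Jordan's inequality, and use |d| + 1/2 ≤ 3/2 in the
factorisation of d² - 1/4. This bounds κ up to and across its removable singularities. The range |d|
≤ 1 is that of a difference of two residuals. -/
lemma abs_sq_sub_le_abs_cos {d : ℝ} (hd : |d| ≤ 1) :
    4 / 3 * |d ^ 2 - 1 / 4| ≤ |Real.cos (Real.pi * d)| := by
  have h1 : Real.cos (Real.pi * d) = Real.sin (Real.pi * (1 / 2 - |d|)) := by
    rw [mul_sub, show Real.pi * (1 / 2) = Real.pi / 2 by ring, Real.sin_pi_div_two_sub]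
    rcases abs_choice d with h | h <;> rw [h]
    rw [mul_neg, Real.cos_neg]
  have h2 := two_mul_abs_le_abs_sin (t := 1 / 2 - |d|)
    (by rw [abs_le]; constructor <;> linarith [abs_nonneg d])
  rw [h1]
  refine le_trans ?_ h2
  have h3 : d ^ 2 - 1 / 4 = (|d| + 1 / 2) * (-(1 / 2 - |d|)) := by rw [← sq_abs d]; ring
  rw [h3, abs_mul, abs_neg, abs_of_nonneg (by positivity : 0 ≤ |d| + 1 / 2)]
  nlinarith [abs_nonneg (1 / 2 - |d|)]

lemma cos_ne_zero_of_ne {d : ℝ} (hd : |d| ≤ 1) (h : ¬(d = 1 / 2 ∨ d = -(1 / 2))) :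
    d ^ 2 - 1 / 4 ≠ 0 ∧ Real.cos (Real.pi * d) ≠ 0 := by
  have h0 : d ^ 2 - 1 / 4 ≠ 0 := by
    intro h1
    have h2 : (d - 1 / 2) * (d - -(1 / 2)) = 0 := by rw [← h1]; ring
    rcases mul_eq_zero.1 h2 with h3 | h3
    · exact h (Or.inl (sub_eq_zero.1 h3))
    · exact h (Or.inr (sub_eq_zero.1 h3))
  refine ⟨h0, fun h1 => ?_⟩
  have h2 := abs_sq_sub_le_abs_cos hd
  rw [h1, abs_zero] at h2
  have := abs_pos.2 h0
  linarith

lemma abs_kappa_le {d : ℝ} (hd : |d| ≤ 1) : |kappa d| ≤ 3 / 4 := by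
  unfold kappa
  split_ifs with h
  · rw [abs_neg, abs_of_pos (by positivity), div_le_iff₀ Real.pi_pos]
    linarith [Real.pi_gt_three]
  · rw [abs_div]
    have h1 := abs_pos.2 (cos_ne_zero_of_ne hd h).2
    rw [div_le_iff₀ h1]
    linarith [abs_sq_sub_le_abs_cos hd]

/-- The limit of the difference of the two noiseless interpolation coefficients. -/
lemma limGain_sub_mul {d : ℝ} (hd : |d| ≤ 1) :
    (limGain (d - 1 / 2) - limGain (d + 1 / 2)) *
      (-(Real.pi * kappa d * osc (-d / 2) * Complex.I)) = 1 := by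
  have hpi : (Real.pi : ℂ) ≠ 0 := by exact_mod_cast Real.pi_ne_zero
  by_cases h : d = 1 / 2 ∨ d = -(1 / 2)
  -- At d = ±1/2 one limiting gain is 1 and the other is 0, which matches the removable value of κ.
  · have hk : kappa d = -(1 / Real.pi) := if_pos h
    rw [hk]
    have h1 : osc 1 = 1 := by exact_mod_cast osc_intCast 1
    have h2 : osc (-1) = 1 := by rw [osc_neg, h1]; simp
    rcases h with rfl | rfl
    · rw [show (1 / 2 - 1 / 2 : ℝ) = 0 by norm_num, show (1 / 2 + 1 / 2 : ℝ) = 1 by norm_num,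
        show (-(1 / 2) / 2 : ℝ) = -(1 / 4) by norm_num, osc_neg, osc_quarter]
      simp only [limGain, h1, if_true, one_ne_zero, if_false]
      push_cast
      field_simp
      simp
    · rw [show (-(1 / 2) - 1 / 2 : ℝ) = -1 by norm_num, show (-(1 / 2) + 1 / 2 : ℝ) = 0 by norm_num,
        show (- -(1 / 2) / 2 : ℝ) = 1 / 4 by norm_num, osc_quarter]
      simp only [limGain, h2, if_true, neg_eq_zero, one_ne_zero, if_false]
      push_cast
      field_simp
      linear_combination (-2 * Real.pi : ℂ) * Complex.I_mul_I
  · obtain ⟨h1, h2⟩ := cos_ne_zero_of_ne hd h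
    have ha := limGain_mul (d - 1 / 2)
    have hb := limGain_mul (d + 1 / 2)
    rw [osc_sub_half, sub_neg_eq_add, one_add_osc] at ha
    rw [osc_add_half, sub_neg_eq_add, one_add_osc] at hb
    have hk : kappa d * Real.cos (Real.pi * d) = d ^ 2 - 1 / 4 := by
      rw [kappa, if_neg h]; exact div_mul_cancel₀ _ h2
    have hk' : (kappa d : ℂ) * Real.cos (Real.pi * d) = d ^ 2 - 1 / 4 := by
      rw [← Complex.ofReal_mul, hk]; push_cast; ring
    have ho : osc (d / 2) * osc (-d / 2) = 1 := by rw [neg_div]; exact osc_mul_osc_neg _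
    have h3 : ((d : ℂ) ^ 2 - 1 / 4) ≠ 0 := by
      have : (((d ^ 2 - 1 / 4 : ℝ)) : ℂ) ≠ 0 := by exact_mod_cast h1
      convert this using 1; push_cast; ring
    rw [show ((d - 1 / 2 : ℝ) : ℂ) = d - 1 / 2 by push_cast; ring] at ha
    rw [show ((d + 1 / 2 : ℝ) : ℂ) = d + 1 / 2 by push_cast; ring] at hb
    set a := limGain (d - 1 / 2)
    set b := limGain (d + 1 / 2)
    set c := (Real.cos (Real.pi * d) : ℂ)
    set k := (kappa d : ℂ)
    set o := osc (d / 2)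
    set o' := osc (-d / 2)
    -- Both gains have the numerator 1 + e^{j2πd} = 2 cos(πd) e^{jπd}, and 1/(d - 1/2) - 1/(d + 1/2)
    -- = 1/(d² - 1/4).
    have e1 : a * (d - 1 / 2) * (d + 1 / 2) * (-(2 * Real.pi * Complex.I)) = 2 * c * o * (d + 1 / 2) := by
      rw [← ha]; ring
    have e2 : b * (d + 1 / 2) * (d - 1 / 2) * (-(2 * Real.pi * Complex.I)) = 2 * c * o * (d - 1 / 2) := by
      rw [← hb]; ring
    have e3 : (a - b) * ((d : ℂ) ^ 2 - 1 / 4) * (-(Real.pi * Complex.I)) = c * o := by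
      linear_combination (1 / 2) * e1 - (1 / 2) * e2
    refine mul_right_cancel₀ h3 ?_
    linear_combination k * o' * e3 + c * k * ho + hk'

/-- The slope of the noiseless coefficients has modulus at most 2, so its reciprocal, of modulus
π|κ|, is at least 1/2. This keeps the asymptotic variance from degenerating, uniformly in d. -/
lemma one_le_abs_kappa {d : ℝ} (hd : |d| ≤ 1) : 1 ≤ 2 * Real.pi * |kappa d| := by
  have h := congrArg norm (limGain_sub_mul hd)
  simp only [norm_mul, norm_neg, Complex.norm_I, norm_osc, mul_one, Complex.norm_real,
    Real.norm_eq_abs, abs_of_pos Real.pi_pos, norm_one] at h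
  have h2 : ‖limGain (d - 1 / 2) - limGain (d + 1 / 2)‖ ≤ 2 :=
    (norm_sub_le _ _).trans (by linarith [norm_limGain_le (d - 1 / 2), norm_limGain_le (d + 1 / 2)])
  rw [← h, mul_assoc]
  gcongr

/-! ### The estimator as a function of the perturbed coefficients -/

/-- The residual estimate from perturbed coefficients of an exponential with residual `d`. -/
lemma residualEst_perturbed {N : ℕ} (hN : 4 ≤ N) {d : ℝ} (hd : |d| ≤ 1) {a b εp εm : ℂ}
    (hab : a - b ≠ 0)
    (h0 : (1 - osc ((d - 1 / 2) / N)) * a = (1 - osc ((d + 1 / 2) / N)) * b)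
    (hY : ‖(a - b)⁻¹ * (εp - εm)‖ ≤ 1 / 2) {γ : ℂ} (hγ : ‖γ‖ ≤ 1 / 2)
    (hγ_def : γ = (-(1 - osc ((d - 1 / 2) / N)) * εp + (1 - osc ((d + 1 / 2) / N)) * εm)
      * (a - b)⁻¹ / (1 + (a - b)⁻¹ * (εp - εm))) :
    residualEst N (a + εp) (b + εm) = d - N / (2 * Real.pi) * (Complex.log (1 + γ)).im := by
  have hN' : (4 : ℝ) ≤ N := by exact_mod_cast hN
  have hN0 : (N : ℝ) ≠ 0 := by linarith
  have hpi := Real.pi_pos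
  have hY1 : 1 + (a - b)⁻¹ * (εp - εm) ≠ 0 := by
    intro h
    rw [eq_neg_of_add_eq_zero_right h] at hY; norm_num at hY
  have hγ1 : 1 + γ ≠ 0 := by
    intro h
    rw [eq_neg_of_add_eq_zero_right h] at hγ; norm_num at hγ
  have hD : (a + εp) - (b + εm) ≠ 0 := by
    have : (a + εp) - (b + εm) = (a - b) * (1 + (a - b)⁻¹ * (εp - εm)) := by
      field_simp; ring
    rw [this]; exact mul_ne_zero hab hY1
  -- Here s = e^{jπ/N}; cosine and sine of π/N become (s ± s⁻¹) up to constants, so the claim is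
  -- rational in z and s.
  set z := osc (d / N) with hz
  set s := osc (1 / (2 * N)) with hs
  have hz0 : z ≠ 0 := osc_ne_zero _
  have hs0 : s ≠ 0 := osc_ne_zero _
  have e1 : osc ((d - 1 / 2) / N) = z * s⁻¹ := by
    rw [hs, ← osc_neg, ← osc_add]; congr 1; field_simp; ring
  have e2 : osc ((d + 1 / 2) / N) = z * s := by
    rw [← osc_add]; congr 1; field_simp
  rw [e1, e2] at h0 hγ_def
  have hc : (Real.cos (Real.pi / N) : ℂ) = (s + s⁻¹) / 2 := by
    rw [hs, ← osc_neg]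
    have : (2 * Real.cos (Real.pi / N) : ℂ) = 2 * Complex.cos (Real.pi / N : ℝ) := by push_cast; rfl
    rw [eq_div_iff two_ne_zero, mul_comm, this, Complex.two_cos, osc, osc]
    congr 2 <;> push_cast <;> field_simp
  have hsn : (Real.sin (Real.pi / N) : ℂ) * (2 * Complex.I) = s - s⁻¹ := by
    rw [hs, ← osc_neg]
    have : (2 * Real.sin (Real.pi / N) : ℂ) = 2 * Complex.sin (Real.pi / N : ℝ) := by push_cast; rfl
    rw [← mul_assoc, mul_comm (Real.sin (Real.pi / N) : ℂ), this, Complex.two_sin, osc, osc, mul_assoc,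
      Complex.I_mul_I]
    rw [mul_neg_one, neg_sub]
    congr 2 <;> push_cast <;> field_simp
  set Sp := a + εp with hSp
  set Sm := b + εm with hSm
  -- The left side is (s⁻¹ Sp - s Sm)/(Sp - Sm). After multiplication by z and subtraction of 1, the
  -- noiseless part of the numerator cancels by `h0`, which leaves γ.
  have hR : (Real.cos (Real.pi / N) : ℂ)
      - 2 * Complex.I * interp Sp Sm * (Real.sin (Real.pi / N) : ℂ) = z⁻¹ * (1 + γ) := by
    have h1 : 1 + γ = (-(1 - z * s⁻¹) * Sp + (1 - z * s) * Sm) / (Sp - Sm) + 1 := by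
      rw [add_comm, hγ_def]
      congr 1
      rw [eq_div_iff hD]
      have : Sp - Sm = (a - b) * (1 + (a - b)⁻¹ * (εp - εm)) := by
        rw [hSp, hSm]; field_simp; ring
      rw [this]
      generalize 1 + (a - b)⁻¹ * (εp - εm) = Y at hY1 ⊢
      have h2 : ∀ X : ℂ, X * (a - b)⁻¹ / Y * ((a - b) * Y) = X := fun X => by field_simp
      rw [h2, hSp, hSm]
      linear_combination h0
    rw [h1, interp]
    have h2 : 2 * Complex.I * (1 / 2 * ((Sp + Sm) / (Sp - Sm))) * (Real.sin (Real.pi / N) : ℂ)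
        = (Sp + Sm) / (Sp - Sm) * ((s - s⁻¹) / 2) := by rw [← hsn]; ring
    rw [h2, hc]
    field_simp
    ring
  unfold residualEst
  rw [hR]
  have hre : 0 < (1 + γ).re := by
    have := (abs_le.1 (Complex.abs_re_le_norm γ)).1
    simp; linarith
  have harg := Complex.abs_arg_lt_pi_div_two_iff.2 (Or.inl hre)
  rw [abs_lt] at harg
  -- This is where N ≥ 4 matters: with arg(1 + γ) in (-π/2, π/2), the total phase stays inside (-π,
  -- π) and the principal logarithm splits.
  have hdN : |2 * Real.pi * (d / N)| ≤ Real.pi / 2 := by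
    rw [abs_mul, abs_div, Nat.abs_cast, abs_of_pos (by positivity : 0 < 2 * Real.pi), ← mul_div_assoc,
      div_le_iff₀ (by linarith)]
    nlinarith [abs_nonneg d]
  rw [abs_le] at hdN
  have hlog : Complex.log (z⁻¹ * (1 + γ)) =
      Complex.log (1 + γ) - ((2 * Real.pi * (d / N) : ℝ) : ℂ) * Complex.I := by
    have h1 : z⁻¹ * (1 + γ) =
        Complex.exp (Complex.log (1 + γ) - ((2 * Real.pi * (d / N) : ℝ) : ℂ) * Complex.I) := by
      rw [Complex.exp_sub, Complex.exp_log hγ1, hz, osc_eq, mul_comm Complex.I]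
      field_simp
    have him : (Complex.log (1 + γ) - ((2 * Real.pi * (d / N) : ℝ) : ℂ) * Complex.I).im =
        Complex.arg (1 + γ) - 2 * Real.pi * (d / N) := by
      rw [Complex.sub_im, Complex.log_im, Complex.im_ofReal_mul, Complex.I_im, mul_one]
    rw [h1, Complex.log_exp]
    · rw [him]; linarith
    · rw [him]; linarith
  rw [hlog, Complex.sub_im, Complex.im_ofReal_mul, Complex.I_im, mul_one]
  field_simp
  ring

/-- The principal argument is at most π. This crude bound serves where the expansion is invalid, and
for integrability. -/
lemma abs_residualEst_le (N : ℕ) (a b : ℂ) : |residualEst N a b| ≤ N / 2 := by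
  unfold residualEst
  rw [abs_mul, abs_neg, Complex.log_im, abs_of_nonneg (by positivity)]
  calc _ ≤ N / (2 * Real.pi) * Real.pi := by gcongr; exact Complex.abs_arg_le_pi _
    _ = N / 2 := by field_simp

/-! ### Orders of magnitude -/

section Weight

variable {ι : Type*} {l : Filter ι} {q S : ι → ℝ}

/-- The scale `q ^ k * S ^ m` on which the error terms are measured. -/
def weight (q S : ι → ℝ) (k m : ℕ) (i : ι) : ℝ := q i ^ k * S i ^ m

/-- As q ≤ 1 ≤ S, factors of q may be dropped and factors of S added, so that different errors can
be brought to one scale. -/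
lemma weight_isBigO (hq0 : ∀ i, 0 ≤ q i) (hq1 : ∀ i, q i ≤ 1) (hS : ∀ i, 1 ≤ S i)
    {k k' m m' : ℕ} (hk : k' ≤ k) (hm : m ≤ m') : weight q S k m =O[l] weight q S k' m' := by
  refine IsBigO.of_bound 1 (Eventually.of_forall fun i => ?_)
  have h1 := pow_le_pow_of_le_one (hq0 i) (hq1 i) hk
  have h2 := pow_le_pow_right₀ (hS i) hm
  have h0 := hq0 i
  have h0' : 0 ≤ S i := zero_le_one.trans (hS i)
  rw [one_mul, Real.norm_of_nonneg (by unfold weight; positivity),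
    Real.norm_of_nonneg (by unfold weight; positivity)]
  unfold weight
  gcongr

lemma isBigO_weight_mul {f g : ι → ℂ} {k k' m m' : ℕ} (hf : f =O[l] weight q S k m)
    (hg : g =O[l] weight q S k' m') :
    (fun i => f i * g i) =O[l] weight q S (k + k') (m + m') :=
  (hf.mul hg).congr_right fun i => by unfold weight; ring

lemma isBigO_pow_mul {f : ι → ℂ} {k m : ℕ} (hf : f =O[l] weight q S k m) (j : ℕ) :
    (fun i => (q i : ℂ) ^ j * f i) =O[l] weight q S (j + k) m := by
  have h : (fun i => (q i : ℂ) ^ j) =O[l] fun i => q i ^ j :=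
    IsBigO.of_bound 1 (Eventually.of_forall fun i => by simp)
  exact (h.mul hf).congr_right fun i => by unfold weight; ring

/-- Second-order expansion of the logarithm of a ratio of perturbed coefficients. -/
lemma log_one_add_expansion (hq0 : ∀ i, 0 ≤ q i) (hq1 : ∀ i, q i ≤ 1) (hS : ∀ i, 1 ≤ S i)
    {U V D p p' E Wp Wm Bp Bm ηp ηm εp εm γ : ι → ℂ}
    (hU : U =O[l] weight q S 0 0) (hV : V =O[l] weight q S 0 0) (hD : D =O[l] weight q S 0 0)
    (hp : (fun i => p i - U i) =O[l] weight q S 2 0)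
    (hp' : (fun i => p' i - V i) =O[l] weight q S 2 0)
    (hE : (fun i => E i - D i) =O[l] weight q S 2 0)
    (hWp : Wp =O[l] weight q S 1 1) (hWm : Wm =O[l] weight q S 1 1)
    (hBp : Bp =O[l] weight q S 0 0) (hBm : Bm =O[l] weight q S 0 0)
    (hηp : ηp =O[l] weight q S 3 1) (hηm : ηm =O[l] weight q S 3 1)
    (hεp : ∀ i, εp i = Wp i + (q i : ℂ) ^ 2 * Bp i + ηp i)
    (hεm : ∀ i, εm i = Wm i + (q i : ℂ) ^ 2 * Bm i + ηm i)
    (hY : ∀ᶠ i in l, ‖E i * (εp i - εm i)‖ ≤ 1 / 2)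
    (hγ : ∀ᶠ i in l, ‖γ i‖ ≤ 1 / 2)
    (hγ_def : ∀ i, γ i = (q i : ℂ) ^ 2 * (p i * εp i + p' i * εm i) / (1 + E i * (εp i - εm i))) :
    (fun i => Complex.log (1 + γ i) - (q i : ℂ) ^ 2 * (U i * Wp i + V i * Wm i
      + (q i : ℂ) ^ 2 * (U i * Bp i + V i * Bm i)
      - (U i * Wp i + V i * Wm i) * (D i * (Wp i - Wm i)))) =O[l] weight q S 5 3 := by
  have mono : ∀ {k k' m m' : ℕ} {f : ι → ℂ}, f =O[l] weight q S k m → k' ≤ k → m ≤ m' →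
      f =O[l] weight q S k' m' := fun hf hk hm => hf.trans (weight_isBigO hq0 hq1 hS hk hm)
  have hep : (fun i => εp i - Wp i) =O[l] weight q S 2 1 :=
    ((mono (isBigO_pow_mul hBp 2) le_rfl (Nat.zero_le 1)).add (mono hηp (by norm_num) le_rfl)).congr_left
      fun i => by rw [hεp]; ring
  have hem : (fun i => εm i - Wm i) =O[l] weight q S 2 1 :=
    ((mono (isBigO_pow_mul hBm 2) le_rfl (Nat.zero_le 1)).add (mono hηm (by norm_num) le_rfl)).congr_left
      fun i => by rw [hεm]; ring
  have hεpO : εp =O[l] weight q S 1 1 :=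
    ((mono hep (by norm_num) le_rfl).add hWp).congr_left fun i => by ring
  have hεmO : εm =O[l] weight q S 1 1 :=
    ((mono hem (by norm_num) le_rfl).add hWm).congr_left fun i => by ring
  have hX0 : (fun i => U i * Wp i + V i * Wm i) =O[l] weight q S 1 1 :=
    (isBigO_weight_mul hU hWp).add (isBigO_weight_mul hV hWm)
  have hX1 : (fun i => (q i : ℂ) ^ 2 * (U i * Bp i + V i * Bm i)) =O[l] weight q S 2 0 :=
    isBigO_pow_mul ((isBigO_weight_mul hU hBp).add (isBigO_weight_mul hV hBm)) 2
  have hX : (fun i => (p i * εp i + p' i * εm i) - (U i * Wp i + V i * Wm i)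
      - (q i : ℂ) ^ 2 * (U i * Bp i + V i * Bm i)) =O[l] weight q S 3 1 :=
    (((isBigO_weight_mul hp hεpO).add (isBigO_weight_mul hp' hεmO)).add
      ((isBigO_weight_mul hU hηp).add (isBigO_weight_mul hV hηm))).congr_left
        fun i => by rw [hεp, hεm]; ring
  have hXX0 : (fun i => (p i * εp i + p' i * εm i) - (U i * Wp i + V i * Wm i))
      =O[l] weight q S 2 1 :=
    ((mono hX (by norm_num) le_rfl).add (mono hX1 le_rfl (Nat.zero_le 1))).congr_left fun i => by ring
  have hXO : (fun i => p i * εp i + p' i * εm i) =O[l] weight q S 1 1 :=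
    ((mono hXX0 (by norm_num) le_rfl).add hX0).congr_left fun i => by ring
  have hEO : E =O[l] weight q S 0 0 :=
    ((mono hE (by norm_num) le_rfl).add hD).congr_left fun i => by ring
  have hYO : (fun i => E i * (εp i - εm i)) =O[l] weight q S 1 1 :=
    isBigO_weight_mul hEO (hεpO.sub hεmO)
  have hYY0 : (fun i => E i * (εp i - εm i) - D i * (Wp i - Wm i)) =O[l] weight q S 2 1 :=
    ((mono (isBigO_weight_mul hE (hεpO.sub hεmO)) (by norm_num) le_rfl).add
      (isBigO_weight_mul hD (hep.sub hem))).congr_left fun i => by ring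
  have hXY : (fun i => (p i * εp i + p' i * εm i) * (E i * (εp i - εm i))
      - (U i * Wp i + V i * Wm i) * (D i * (Wp i - Wm i))) =O[l] weight q S 3 2 := by
    have h1 := isBigO_weight_mul hXX0 hYO
    have h2 := isBigO_weight_mul hX0 hYY0
    exact (h1.add h2).congr_left fun i => by ring
  have hinv : (fun i => (1 + E i * (εp i - εm i))⁻¹) =O[l] weight q S 0 0 := by
    refine IsBigO.of_bound 2 ?_
    filter_upwards [hY] with i hi
    have h1 : 1 / 2 ≤ ‖1 + E i * (εp i - εm i)‖ := by
      have := norm_sub_norm_le (1 : ℂ) (-(E i * (εp i - εm i)))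
      rw [norm_neg, norm_one, sub_neg_eq_add] at this
      linarith
    rw [norm_inv]
    simp only [weight, pow_zero, mul_one, norm_one]
    rw [inv_le_comm₀ (by linarith) (by norm_num)]
    linarith
  have hne : ∀ᶠ i in l, 1 + E i * (εp i - εm i) ≠ 0 := by
    filter_upwards [hY] with i hi h
    rw [eq_neg_of_add_eq_zero_right h] at hi; norm_num at hi
  -- With X the numerator and Y the denominator perturbation, X/(1 + Y) = X - XY + XY²/(1 + Y); the
  -- last term is O(q³S³), and X and XY are replaced by their leading parts.
  have hrat : (fun i => (p i * εp i + p' i * εm i) * (1 + E i * (εp i - εm i))⁻¹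
      - (U i * Wp i + V i * Wm i + (q i : ℂ) ^ 2 * (U i * Bp i + V i * Bm i)
        - (U i * Wp i + V i * Wm i) * (D i * (Wp i - Wm i)))) =O[l] weight q S 3 3 := by
    have h1 := isBigO_weight_mul (isBigO_weight_mul hXO (isBigO_weight_mul hYO hYO)) hinv
    refine ((mono h1 le_rfl le_rfl).add
      ((mono hX le_rfl (by norm_num : 1 ≤ 3)).sub (mono hXY le_rfl (by norm_num : 2 ≤ 3)))).congr' ?_
        EventuallyEq.rfl
    filter_upwards [hne] with i hi
    field_simp
    ring
  have hγO : γ =O[l] weight q S 3 1 :=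
    (isBigO_pow_mul (isBigO_weight_mul hXO hinv) 2).congr_left fun i => by
      rw [hγ_def, div_eq_mul_inv, mul_assoc]
  have hlog : (fun i => Complex.log (1 + γ i) - γ i) =O[l] weight q S 6 2 := by
    refine IsBigO.trans (IsBigO.of_bound 1 ?_) (isBigO_weight_mul hγO hγO)
    filter_upwards [hγ] with i hi
    refine (Complex.norm_log_one_add_sub_self_le (by linarith)).trans ?_
    have : (1 - ‖γ i‖)⁻¹ ≤ 2 := by
      rw [inv_le_comm₀ (by linarith) (by norm_num)]; linarith
    rw [norm_mul]
    nlinarith [mul_nonneg (norm_nonneg (γ i)) (norm_nonneg (γ i))]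
  refine ((mono hlog (by norm_num) (by norm_num)).add (isBigO_pow_mul hrat 2)).congr_left fun i => ?_
  rw [hγ_def i]
  ring

/-- To be used with x = q²S and w the modulus of the noise. If x < 1, both w and x are at most √x,
so c ≤ (1 + C)√x; if x ≥ 1, the summand 1 suffices. A perturbation above a fixed threshold thus
costs a factor q²S. -/
lemma one_le_mul_of_le_add {c C x w : ℝ} (hc : 0 < c) (hC : 0 ≤ C) (hx : 0 ≤ x)
    (hwx : w ^ 2 ≤ x) (h : c ≤ w + C * x) : 1 ≤ (1 + ((1 + C) / c) ^ 2) * x := by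
  by_cases h1 : 1 ≤ x
  · nlinarith [sq_nonneg ((1 + C) / c)]
  push Not at h1
  have hs : √x ^ 2 = x := Real.sq_sqrt hx
  have hs0 := Real.sqrt_nonneg x
  have hs1 : √x ≤ 1 := by nlinarith
  have hws : w ≤ √x := Real.le_sqrt_of_sq_le hwx
  have hcs : c ≤ (1 + C) * √x := by
    have : x ≤ √x := by nlinarith
    have := mul_le_mul_of_nonneg_left this hC
    linarith
  have h2 : 1 ≤ (1 + C) / c * √x := by
    rw [div_mul_eq_mul_div, one_le_div hc]; exact hcs
  have h3 : 1 ≤ ((1 + C) / c * √x) ^ 2 := one_le_pow₀ h2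
  rw [mul_pow, hs] at h3
  linarith

/-- The remainder of the second-order expansion, including the event where the perturbation is
too large for the expansion to be valid. -/
lemma log_remainder_isBigO (hq0 : ∀ i, 0 ≤ q i) (hq1 : ∀ i, q i ≤ 1) (hS : ∀ i, 1 ≤ S i)
    {U V D p p' E Wp Wm Bp Bm ηp ηm εp εm γ : ι → ℂ} {F : ι → ℝ}
    (hU : U =O[l] weight q S 0 0) (hV : V =O[l] weight q S 0 0) (hD : D =O[l] weight q S 0 0)
    (hp : (fun i => p i - U i) =O[l] weight q S 2 0)
    (hp' : (fun i => p' i - V i) =O[l] weight q S 2 0)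
    (hE : (fun i => E i - D i) =O[l] weight q S 2 0)
    (hWp : ∀ i, ‖Wp i‖ ^ 2 ≤ q i ^ 2 * S i) (hWm : ∀ i, ‖Wm i‖ ^ 2 ≤ q i ^ 2 * S i)
    (hBp : Bp =O[l] weight q S 0 0) (hBm : Bm =O[l] weight q S 0 0)
    (hηp : ηp =O[l] weight q S 3 1) (hηm : ηm =O[l] weight q S 3 1)
    (hεp : ∀ i, εp i = Wp i + (q i : ℂ) ^ 2 * Bp i + ηp i)
    (hεm : ∀ i, εm i = Wm i + (q i : ℂ) ^ 2 * Bm i + ηm i)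
    (hγ_def : ∀ i, γ i = (q i : ℂ) ^ 2 * (p i * εp i + p' i * εm i) / (1 + E i * (εp i - εm i)))
    (hF1 : F =O[l] weight q S 0 0)
    (hF : ∀ᶠ i in l, ‖E i * (εp i - εm i)‖ ≤ 1 / 2 → ‖γ i‖ ≤ 1 / 2 →
      F i = -(1 / (2 * Real.pi)) * (Complex.log (1 + γ i)).im) :
    (fun i => F i + 1 / (2 * Real.pi) * ((q i : ℂ) ^ 2 * (U i * Wp i + V i * Wm i
      + (q i : ℂ) ^ 2 * (U i * Bp i + V i * Bm i)
      - (U i * Wp i + V i * Wm i) * (D i * (Wp i - Wm i)))).im) =O[l] weight q S 5 3 := by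
  have mono : ∀ {l : Filter ι} {k k' m m' : ℕ} {f : ι → ℂ}, f =O[l] weight q S k m → k' ≤ k → m ≤ m' →
      f =O[l] weight q S k' m' := fun hf hk hm => hf.trans (weight_isBigO hq0 hq1 hS hk hm)
  have hWO : ∀ W : ι → ℂ, (∀ i, ‖W i‖ ^ 2 ≤ q i ^ 2 * S i) → W =O[l] weight q S 1 1 := by
    intro W hW
    refine IsBigO.of_bound 1 (Eventually.of_forall fun i => ?_)
    have h0 := hq0 i
    have h1 := hS i
    rw [one_mul, Real.norm_of_nonneg (by unfold weight; positivity)]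
    simp only [weight, pow_one]
    refine abs_le_of_sq_le_sq' ?_ (by positivity) |>.2
    calc ‖W i‖ ^ 2 ≤ q i ^ 2 * S i := hW i
      _ ≤ (q i * S i) ^ 2 := by rw [mul_pow]; gcongr; nlinarith
  have hWpO := hWO Wp hWp
  have hWmO := hWO Wm hWm
  have hep : (fun i => εp i - Wp i) =O[l] weight q S 2 1 :=
    ((mono (isBigO_pow_mul hBp 2) le_rfl (Nat.zero_le 1)).add (mono hηp (by norm_num) le_rfl)).congr_left
      fun i => by rw [hεp]; ring
  have hem : (fun i => εm i - Wm i) =O[l] weight q S 2 1 :=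
    ((mono (isBigO_pow_mul hBm 2) le_rfl (Nat.zero_le 1)).add (mono hηm (by norm_num) le_rfl)).congr_left
      fun i => by rw [hεm]; ring
  have hpO : p =O[l] weight q S 0 0 :=
    ((mono hp (by norm_num) le_rfl).add hU).congr_left fun i => by ring
  have hpO' : p' =O[l] weight q S 0 0 :=
    ((mono hp' (by norm_num) le_rfl).add hV).congr_left fun i => by ring
  have hEO : E =O[l] weight q S 0 0 :=
    ((mono hE (by norm_num) le_rfl).add hD).congr_left fun i => by ring
  obtain ⟨C₁, hC₁, hEb⟩ := hEO.exists_pos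
  obtain ⟨C₂, hC₂, hpb⟩ := hpO.exists_pos
  obtain ⟨C₃, hC₃, hpb'⟩ := hpO'.exists_pos
  obtain ⟨C₄, hC₄, hepb⟩ := hep.exists_pos
  obtain ⟨C₅, hC₅, hemb⟩ := hem.exists_pos
  have hEb := hEb.bound
  have hpb := hpb.bound
  have hpb' := hpb'.bound
  have hepb := hepb.bound
  have hemb := hemb.bound
  simp only [weight, pow_zero, mul_one, norm_one] at hEb hpb hpb'
  -- Small enough that perturbations below `c` make both E(εp - εm) and γ at most 1/2 in modulus.
  set c : ℝ := 1 / (4 * (C₁ + C₂ + C₃)) with hc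
  have hc0 : 0 < c := by positivity
  have hcm : c * (C₁ + C₂ + C₃) = 1 / 4 := by rw [hc]; field_simp
  set G : Set ι := {i | ‖εp i‖ ≤ c ∧ ‖εm i‖ ≤ c} with hG
  have hgood : ∀ᶠ i in l, i ∈ G → ‖E i * (εp i - εm i)‖ ≤ 1 / 2 ∧ ‖γ i‖ ≤ 1 / 2 := by
    filter_upwards [hEb, hpb, hpb'] with i h1 h2 h3 hi
    have hδ : ‖εp i - εm i‖ ≤ 2 * c := (norm_sub_le _ _).trans (by linarith [hi.1, hi.2])
    have hY : ‖E i * (εp i - εm i)‖ ≤ 1 / 2 := by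
      rw [norm_mul]
      calc _ ≤ C₁ * (2 * c) := by gcongr
        _ ≤ _ := by nlinarith
    refine ⟨hY, ?_⟩
    have h4 : 1 / 2 ≤ ‖1 + E i * (εp i - εm i)‖ := by
      have := norm_sub_norm_le (1 : ℂ) (-(E i * (εp i - εm i)))
      rw [norm_neg, norm_one, sub_neg_eq_add] at this
      linarith
    have h5 : ‖p i * εp i + p' i * εm i‖ ≤ 1 / 4 := by
      refine (norm_add_le _ _).trans ?_
      rw [norm_mul, norm_mul]
      calc _ ≤ C₂ * c + C₃ * c := by gcongr; exacts [hi.1, hi.2]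
        _ ≤ _ := by nlinarith
    rw [hγ_def, norm_div, norm_mul, norm_pow, Complex.norm_real, Real.norm_of_nonneg (hq0 i),
      div_le_iff₀ (by linarith)]
    have h6 : q i ^ 2 ≤ 1 := pow_le_one₀ (hq0 i) (hq1 i)
    nlinarith [norm_nonneg (p i * εp i + p' i * εm i), sq_nonneg (q i)]
  have hexp : (fun i => F i + 1 / (2 * Real.pi) * ((q i : ℂ) ^ 2 * (U i * Wp i + V i * Wm i
      + (q i : ℂ) ^ 2 * (U i * Bp i + V i * Bm i)
      - (U i * Wp i + V i * Wm i) * (D i * (Wp i - Wm i)))).im) =O[l ⊓ 𝓟 G] weight q S 5 3 := by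
    have hl : l ⊓ 𝓟 G ≤ l := inf_le_left
    have hev : ∀ᶠ i in l ⊓ 𝓟 G, ‖E i * (εp i - εm i)‖ ≤ 1 / 2 ∧ ‖γ i‖ ≤ 1 / 2 := by
      rw [eventually_inf_principal]; exact hgood
    have h := log_one_add_expansion hq0 hq1 hS (hU.mono hl) (hV.mono hl) (hD.mono hl) (hp.mono hl)
      (hp'.mono hl) (hE.mono hl) (hWpO.mono hl) (hWmO.mono hl) (hBp.mono hl) (hBm.mono hl)
      (hηp.mono hl) (hηm.mono hl) hεp hεm (hev.mono fun i h => h.1) (hev.mono fun i h => h.2) hγ_def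
    refine IsBigO.trans (IsBigO.of_bound 1 ?_) h
    filter_upwards [hev, hl hF] with i hi hFi
    rw [hFi hi.1 hi.2, one_mul]
    have hpi := Real.pi_gt_three
    have : ∀ a b : ℂ, -(1 / (2 * Real.pi)) * a.im + 1 / (2 * Real.pi) * b.im
        = -(1 / (2 * Real.pi)) * (a - b).im := fun a b => by rw [Complex.sub_im]; ring
    rw [this, norm_mul, norm_neg, Real.norm_of_nonneg (by positivity), Real.norm_eq_abs]
    refine le_trans (mul_le_of_le_one_left (abs_nonneg _) ?_) (Complex.abs_im_le_norm _)
    rw [div_le_one (by positivity)]; linarith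
  -- Off the good set 1 = O(q²S), so any quantity may be multiplied by q²S there at the cost of a
  -- constant.
  have hbad1 : (fun _ => (1 : ℝ)) =O[l ⊓ 𝓟 Gᶜ] weight q S 2 1 := by
    refine IsBigO.of_bound ((1 + ((1 + C₄) / c) ^ 2) + (1 + ((1 + C₅) / c) ^ 2)) ?_
    rw [eventually_inf_principal]
    filter_upwards [hepb, hemb] with i h1 h2 hi
    have h0 := hq0 i
    have h0' : 0 ≤ S i := zero_le_one.trans (hS i)
    have hw0 : 0 ≤ weight q S 2 1 i := by unfold weight; positivity
    rw [Real.norm_of_nonneg hw0] at h1 h2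
    rw [norm_one, Real.norm_of_nonneg hw0]
    simp only [weight, pow_one] at h1 h2 ⊢
    have hx : 0 ≤ q i ^ 2 * S i := by positivity
    have hi' : c < ‖εp i‖ ∨ c < ‖εm i‖ := by
      by_contra! h
      exact hi h
    rcases hi' with h | h
    · have h3 : ‖εp i‖ ≤ ‖Wp i‖ + ‖εp i - Wp i‖ := norm_le_norm_add_norm_sub' _ _
      have := one_le_mul_of_le_add hc0 hC₄.le hx (hWp i) (by linarith)
      exact this.trans (mul_le_mul_of_nonneg_right (le_add_of_nonneg_right (by positivity)) hx)
    · have h3 : ‖εm i‖ ≤ ‖Wm i‖ + ‖εm i - Wm i‖ := norm_le_norm_add_norm_sub' _ _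
      have := one_le_mul_of_le_add hc0 hC₅.le hx (hWm i) (by linarith)
      exact this.trans (mul_le_mul_of_nonneg_right (le_add_of_nonneg_left (by positivity)) hx)
  have hX0 : (fun i => U i * Wp i + V i * Wm i) =O[l] weight q S 1 1 :=
    (isBigO_weight_mul hU hWpO).add (isBigO_weight_mul hV hWmO)
  have hX1 : (fun i => (q i : ℂ) ^ 2 * (U i * Bp i + V i * Bm i)) =O[l] weight q S 2 0 :=
    isBigO_pow_mul ((isBigO_weight_mul hU hBp).add (isBigO_weight_mul hV hBm)) 2
  have hX2 : (fun i => (U i * Wp i + V i * Wm i) * (D i * (Wp i - Wm i))) =O[l] weight q S 2 2 :=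
    isBigO_weight_mul hX0 (isBigO_weight_mul hD (hWpO.sub hWmO))
  have hT := isBigO_pow_mul (((mono hX0 le_rfl (by norm_num : 1 ≤ 2)).add
    (mono hX1 (by norm_num : 1 ≤ 2) (by norm_num : 0 ≤ 2))).sub (mono hX2 (by norm_num : 1 ≤ 2) le_rfl)) 2
  have hTim : (fun i => 1 / (2 * Real.pi) * ((q i : ℂ) ^ 2 * (U i * Wp i + V i * Wm i
      + (q i : ℂ) ^ 2 * (U i * Bp i + V i * Bm i)
      - (U i * Wp i + V i * Wm i) * (D i * (Wp i - Wm i)))).im) =O[l] weight q S 3 2 := by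
    refine IsBigO.const_mul_left (IsBigO.trans (IsBigO.of_bound 1 (Eventually.of_forall fun i => ?_)) hT) _
    rw [one_mul, Real.norm_eq_abs]
    exact Complex.abs_im_le_norm _
  have hbad : (fun i => F i + 1 / (2 * Real.pi) * ((q i : ℂ) ^ 2 * (U i * Wp i + V i * Wm i
      + (q i : ℂ) ^ 2 * (U i * Bp i + V i * Bm i)
      - (U i * Wp i + V i * Wm i) * (D i * (Wp i - Wm i)))).im) =O[l ⊓ 𝓟 Gᶜ] weight q S 5 3 := by
    have hl : l ⊓ 𝓟 Gᶜ ≤ l := inf_le_left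
    have h1 : F =O[l ⊓ 𝓟 Gᶜ] weight q S 6 3 := by
      -- Three uses give q⁶S³ for the bounded error `F`; one use takes the main terms from q³S² to
      -- q⁵S³. This is why the remainder carries S³.
      have := (((hF1.mono hl).mul hbad1).mul hbad1).mul hbad1
      refine this.congr (fun i => by ring) fun i => by unfold weight; ring
    have h2 := ((hTim.mono hl).mul hbad1).congr (fun i => mul_one _)
      (fun i => show _ = weight q S 5 3 i by unfold weight; ring)
    exact (h1.trans (weight_isBigO hq0 hq1 hS (by norm_num) le_rfl)).add h2
  refine (hexp.sup hbad).mono ?_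
  rw [← inf_sup_left, sup_principal, Set.union_compl_self, principal_univ, inf_top_eq]

end Weight

/-! ### Expansion of the frequency estimate -/

/-- The limit of the reciprocal of the difference of the two noiseless coefficients. -/
def invSlope (A : ℂ) (d : ℝ) : ℂ := -(Real.pi * kappa d * osc (-d / 2) * Complex.I) / A

/-- The first-order term of the expansion, in terms of the two perturbations. -/
def linTerm (A : ℂ) (d : ℝ) (a b : ℂ) : ℂ :=
  -(Real.pi * Complex.I) * (1 - 2 * d) * invSlope A d * a
    + -(Real.pi * Complex.I) * (1 + 2 * d) * invSlope A d * b

/-- `N ^ (-1/2)`. -/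
def rate (N : ℕ) : ℝ := (√N)⁻¹

lemma rate_nonneg (N : ℕ) : 0 ≤ rate N := by unfold rate; positivity

lemma rate_le_one (N : ℕ) : rate N ≤ 1 := by
  unfold rate
  rcases Nat.eq_zero_or_pos N with rfl | h
  · simp
  · exact inv_le_one_of_one_le₀ (by rw [Real.one_le_sqrt]; exact_mod_cast h)

lemma rate_sq (N : ℕ) : rate N ^ 2 = 1 / N := by
  rw [rate, inv_pow, Real.sq_sqrt (Nat.cast_nonneg _), one_div]

lemma norm_invSlope_le (A : ℂ) {d : ℝ} (hd : |d| ≤ 1) : ‖invSlope A d‖ ≤ 3 / ‖A‖ := by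
  rw [invSlope, norm_div, norm_neg]
  gcongr
  simp only [norm_mul, Complex.norm_I, norm_osc, mul_one, Complex.norm_real, Real.norm_eq_abs,
    abs_of_pos Real.pi_pos]
  nlinarith [abs_kappa_le hd, Real.pi_le_four, Real.pi_pos, abs_nonneg (kappa d)]

/-- The bias is the linear functional of the expansion applied to the leakage residuals. The factors
j of `linTerm` and `invSlope` multiply to -1, which leaves the real weights -π²κ(1 ∓ 2d)/N². -/
lemma bias_eq (N : ℕ) (A₁ A₂ : ℂ) (M : ℤ) (δ₁ δ₂ ν₁ ν₂ : ℝ) :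
    bias N A₁ A₂ M δ₁ δ₂ ν₁ ν₂ = -(1 / (2 * Real.pi)) * (((rate N : ℂ) ^ 2 * ((rate N : ℂ) ^ 2 *
      linTerm A₁ (δ₁ - ν₁) (A₂ * beta N M δ₂ ν₁ ν₂ (1 / 2))
        (A₂ * beta N M δ₂ ν₁ ν₂ (-(1 / 2))))).im) := by
  unfold bias
  have h : (rate N : ℂ) ^ 2 = ((1 / N : ℝ) : ℂ) := by rw [← rate_sq]; push_cast; rfl
  set βp := beta N M δ₂ ν₁ ν₂ (1 / 2)
  set βm := beta N M δ₂ ν₁ ν₂ (-(1 / 2))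
  set d := δ₁ - ν₁ with hd
  have h2 : (rate N : ℂ) ^ 2 * ((rate N : ℂ) ^ 2 * linTerm A₁ d (A₂ * βp) (A₂ * βm)) =
      ((-(Real.pi ^ 2 * kappa d / N ^ 2) * (1 - 2 * d) : ℝ) : ℂ) * (osc (-d / 2) * (A₂ / A₁) * βp)
      + ((-(Real.pi ^ 2 * kappa d / N ^ 2) * (1 + 2 * d) : ℝ) : ℂ) * (osc (-d / 2) * (A₂ / A₁) * βm) := by
    rw [h, linTerm, invSlope]
    push_cast
    linear_combination (Real.pi ^ 2 * kappa d / N ^ 2 * osc (-d / 2) * (A₂ / A₁) : ℂ) *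
      ((1 - 2 * d) * βp + (1 + 2 * d) * βm) * Complex.I_mul_I
  rw [h2, Complex.add_im, Complex.im_ofReal_mul, Complex.im_ofReal_mul]
  have := Real.pi_ne_zero
  field_simp
  ring

/-! ### Separation, slope and leakage of the coefficients -/

/-- Moving a frequency difference by at most 5/2 bins costs at most Δ/2 once N ≥ 5/Δ. The value 5/2
allows for four residuals and the half-bin offset. -/
lemma two_mul_le_norm_one_sub_osc {Δ y t : ℝ} {N : ℕ} (hN : 5 / Δ ≤ N) (hΔ : 0 < Δ)
    (h : ∀ k : ℤ, Δ ≤ |y - k|) (ht : |t| ≤ 5 / 2) : 2 * Δ ≤ ‖1 - osc (y + t / N)‖ := by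
  have hN0 : (0 : ℝ) < N := lt_of_lt_of_le (by positivity) hN
  have h1 : |t / N| ≤ Δ / 2 := by
    rw [abs_div, Nat.abs_cast, div_le_iff₀ hN0]
    rw [div_le_iff₀ hΔ] at hN
    linarith
  have h2 : ∀ k : ℤ, Δ / 2 ≤ |y + t / N - k| := fun k => by
    have h3 := h k
    have h4 : |y - k| ≤ |y + t / N - k| + |t / N| := by
      have := abs_sub (y + t / N - k) (t / N)
      rwa [show y + t / N - k - t / N = y - k by ring] at this
    linarith
  linarith [four_mul_le_norm_one_sub_osc h2]

/-- The noiseless slope and its limit. -/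
lemma slope_estimate {A : ℂ} (hA : A ≠ 0) {N : ℕ} (hN : 180 ≤ N) {d : ℝ} (hd : |d| ≤ 1) :
    A * gain N (d - 1 / 2) - A * gain N (d + 1 / 2) ≠ 0 ∧
    ‖(A * gain N (d - 1 / 2) - A * gain N (d + 1 / 2))⁻¹‖ ≤ 6 / ‖A‖ ∧
    ‖(A * gain N (d - 1 / 2) - A * gain N (d + 1 / 2))⁻¹ - invSlope A d‖ ≤ 540 / ‖A‖ / N := by
  have hN' : (180 : ℝ) ≤ N := by exact_mod_cast hN
  have hA' : 0 < ‖A‖ := norm_pos_iff.2 hA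
  obtain ⟨hd1, hd2⟩ := abs_le.1 hd
  set D := A * gain N (d - 1 / 2) - A * gain N (d + 1 / 2) with hD
  set D' := A * (limGain (d - 1 / 2) - limGain (d + 1 / 2)) with hD'
  have h1 : ‖D - D'‖ ≤ ‖A‖ * (30 / N) := by
    have : D - D' = A * ((gain N (d - 1 / 2) - limGain (d - 1 / 2))
        - (gain N (d + 1 / 2) - limGain (d + 1 / 2))) := by rw [hD, hD']; ring
    rw [this, norm_mul]
    gcongr
    refine (norm_sub_le _ _).trans ?_
    have e1 := norm_gain_sub_limGain_le (N := N) (x := d - 1 / 2) (by omega)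
      (abs_le.2 ⟨by linarith, by linarith⟩)
    have e2 := norm_gain_sub_limGain_le (N := N) (x := d + 1 / 2) (by omega)
      (abs_le.2 ⟨by linarith, by linarith⟩)
    calc _ ≤ (15 / N + 15 / N : ℝ) := add_le_add e1 e2
      _ = _ := by ring
  have h2 : D' * invSlope A d = 1 := by
    rw [hD', invSlope]
    have h3 : ∀ X Y : ℂ, A * X * (Y / A) = X * Y := fun X Y => by field_simp
    rw [h3, limGain_sub_mul hd]
  have h3 : ‖A‖ / 3 ≤ ‖D'‖ := by
    have h4 := congrArg norm h2
    rw [norm_mul, norm_one] at h4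
    have h5 := mul_le_mul_of_nonneg_left (norm_invSlope_le A hd) (norm_nonneg D')
    rw [h4, mul_div_assoc', one_le_div hA'] at h5
    linarith
  have h4 : ‖A‖ / 6 ≤ ‖D‖ := by
    have h5 : ‖D'‖ ≤ ‖D‖ + ‖D - D'‖ := norm_le_norm_add_norm_sub _ _
    -- For N ≥ 180 the error of the two gains uses up at most half of the lower bound `‖A‖ / 3` for
    -- the limiting slope.
    have h6 : ‖A‖ * (30 / N) ≤ ‖A‖ * (1 / 6) := by
      refine mul_le_mul_of_nonneg_left ?_ hA'.le
      rw [div_le_div_iff₀ (by linarith) (by norm_num)]; linarith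
    linarith
  have hD0 : D ≠ 0 := norm_pos_iff.1 (by linarith)
  have h5 : ‖D⁻¹‖ ≤ 6 / ‖A‖ := by
    rw [norm_inv, inv_le_comm₀ (by linarith) (by positivity), inv_div]; exact h4
  refine ⟨hD0, h5, ?_⟩
  have h6 : D⁻¹ - invSlope A d = D⁻¹ * invSlope A d * -(D - D') := by
    field_simp
    linear_combination -h2
  rw [h6, norm_mul, norm_mul, norm_neg]
  calc _ ≤ 6 / ‖A‖ * (3 / ‖A‖) * (‖A‖ * (30 / N)) := by
        gcongr; exact norm_invSlope_le A hd
    _ = _ := by field_simp; ring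

lemma norm_scaled_chord_le {N : ℕ} (hN : 20 ≤ N) {x : ℝ} (hx : |x| ≤ 3 / 2) :
    ‖N * (1 - osc (x / N)) + 2 * Real.pi * x * Complex.I‖ ≤ 144 / N := by
  have hN' : (20 : ℝ) ≤ N := by exact_mod_cast hN
  have habs : |x / N| = |x| / N := by rw [abs_div, Nat.abs_cast]
  have hN0 : (N : ℂ) ≠ 0 := by exact_mod_cast (by omega : N ≠ 0)
  have h4 := norm_osc_sub_one_sub_le (t := x / N) (by
    rw [habs, ← mul_div_assoc, div_le_one (by linarith)]
    calc 2 * Real.pi * |x| ≤ 2 * 4 * (3 / 2) := by gcongr; exact Real.pi_le_four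
      _ ≤ N := by linarith)
  have h5 : N * (1 - osc (x / N)) + 2 * Real.pi * x * Complex.I
      = -(N * (osc (x / N) - 1 - 2 * Real.pi * ((x / N : ℝ) : ℂ) * Complex.I)) := by
    push_cast; field_simp; ring
  rw [h5, norm_neg, norm_mul, Complex.norm_natCast]
  calc _ ≤ N * (2 * Real.pi * |x / N|) ^ 2 := by gcongr
    _ = (2 * Real.pi * |x|) ^ 2 / N := by rw [habs]; field_simp
    _ ≤ (2 * 4 * (3 / 2)) ^ 2 / N := by gcongr; exact Real.pi_le_four
    _ = _ := by norm_num

lemma osc_sub_half_int {r : ℝ} (hr : r = 1 / 2 ∨ r = -(1 / 2)) (M : ℤ) (x : ℝ) :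
    osc (M + x - r) = -osc x := by
  have h : osc (-r) = -1 := by
    rcases hr with rfl | rfl
    · exact osc_neg_half
    · rw [neg_neg, osc_half]
  rw [osc_sub, osc_add, osc_intCast, h]; ring

/-- Decomposition of the leakage-free coefficients into signal, noise, leakage residual and a
term of higher order. -/
lemma leakageFreeCoeff_decomposition {N : ℕ} (hN4 : 4 ≤ N) {Δ : ℝ} (hΔ : 0 < Δ) (hN : 5 / Δ ≤ N)
    {m₁ m₂ : ℤ} {δ₁ δ₂ ν₁ ν₂ : ℝ} (hδ₁ : |δ₁| ≤ 1 / 2) (hδ₂ : |δ₂| ≤ 1 / 2) (hν₁ : |ν₁| ≤ 1 / 2)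
    (hν₂ : |ν₂| ≤ 1 / 2)
    (hsep : ∀ k : ℤ, Δ ≤ |freq N m₁ δ₁ - freq N m₂ δ₂ - k|) (A₁ A₂ B : ℂ) (w : ℕ → ℂ) {r : ℝ}
    (hr : r = 1 / 2 ∨ r = -(1 / 2)) :
    ‖leakageFreeCoeff N (signal A₁ A₂ (freq N m₁ δ₁) (freq N m₂ δ₂) w) (freq N m₁ ν₁)
        (ampEst N (signal A₁ A₂ (freq N m₁ δ₁) (freq N m₂ δ₂) w) (freq N m₂ ν₂) B (freq N m₁ ν₁))
        (freq N m₂ ν₂) r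
      - A₁ * gain N (δ₁ - ν₁ - r) - fourierCoeff N w (freq N m₁ ν₁ + r / N)
      - 1 / N * (A₂ * beta N (m₂ - m₁) δ₂ ν₁ ν₂ r)‖
    ≤ (1 / Δ / N) * (‖fourierCoeff N w (freq N m₂ ν₂)‖ + (‖A₁‖ + ‖B‖) * (1 / Δ / N)) ∧
    ‖beta N (m₂ - m₁) δ₂ ν₁ ν₂ r‖ ≤ 3 / Δ := by
  have hN4' : (4 : ℝ) ≤ N := by exact_mod_cast hN4
  have hN0 : (N : ℝ) ≠ 0 := by linarith
  have hN1 : 1 ≤ N := by omega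
  rw [abs_le] at hδ₁ hδ₂ hν₁ hν₂
  have hr' : |r| ≤ 1 / 2 := by rcases hr with rfl | rfl <;> norm_num [abs_of_pos]
  rw [abs_le] at hr'
  have hsep' : ∀ k : ℤ, Δ ≤ |freq N m₂ δ₂ - freq N m₁ δ₁ - k| := fun k => by
    have := hsep (-k)
    rw [← abs_neg] at this
    convert this using 2
    push_cast; ring
  have c1 : 2 * Δ ≤ ‖1 - osc (((m₂ - m₁ : ℤ) + δ₂ - ν₁ - r) / N)‖ := by
    have := two_mul_le_norm_one_sub_osc (t := δ₁ - ν₁ - r) hN hΔ hsep'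
      (abs_le.2 ⟨by linarith, by linarith⟩)
    convert this using 4
    simp only [freq]; push_cast; field_simp; ring
  have c2 : 2 * Δ ≤ ‖1 - osc (((m₂ - m₁ : ℤ) + ν₂ - ν₁ - r) / N)‖ := by
    have := two_mul_le_norm_one_sub_osc (t := δ₁ - ν₁ - (δ₂ - ν₂) - r) hN hΔ hsep'
      (abs_le.2 ⟨by linarith, by linarith⟩)
    convert this using 4
    simp only [freq]; push_cast; field_simp; ring
  have c3 : 2 * Δ ≤ ‖1 - osc (((m₁ - m₂ : ℤ) + δ₁ - ν₂) / N)‖ := by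
    have := two_mul_le_norm_one_sub_osc (t := δ₂ - ν₂) hN hΔ hsep
      (abs_le.2 ⟨by linarith, by linarith⟩)
    convert this using 4
    simp only [freq]; push_cast; field_simp; ring
  have c4 : 2 * Δ ≤ ‖1 - osc (((m₁ - m₂ : ℤ) + ν₁ - ν₂) / N)‖ := by
    have := two_mul_le_norm_one_sub_osc (t := δ₂ - ν₂ - (δ₁ - ν₁)) hN hΔ hsep
      (abs_le.2 ⟨by linarith, by linarith⟩)
    convert this using 4
    simp only [freq]; push_cast; field_simp; ring
  have hne : ∀ {x : ℝ}, 2 * Δ ≤ ‖1 - osc x‖ → osc x ≠ 1 := fun h h' => by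
    rw [h', sub_self, norm_zero] at h; linarith
  have hgl : |δ₂ - ν₂| ≤ (N : ℝ) / 2 := abs_le.2 ⟨by linarith, by linarith⟩
  have hgd : |δ₁ - ν₁ - r| ≤ (N : ℝ) / 2 := abs_le.2 ⟨by linarith, by linarith⟩
  have h0 : ∀ {x : ℝ}, |x| ≤ (N : ℝ) / 2 → x = 0 ∨ osc (x / N) ≠ 1 := fun {x} h => by
    by_cases hx : x = 0
    · exact Or.inl hx
    · refine Or.inr (osc_ne_one_of_abs_le ?_ (by positivity))
      rw [abs_div, Nat.abs_cast, div_le_iff₀ (by linarith)]; linarith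
  have F1 : ∀ A, fourierCoeff N (tone A (freq N m₁ δ₁)) (freq N m₁ ν₁ + r / N) =
      A * gain N (δ₁ - ν₁ - r) := fun A =>
    fourierCoeff_tone hN1 A (by simp only [freq]; field_simp; ring) (h0 hgd)
  have F2 : ∀ A, fourierCoeff N (tone A (freq N m₂ δ₂)) (freq N m₁ ν₁ + r / N) =
      A * gain N ((m₂ - m₁ : ℤ) + δ₂ - ν₁ - r) := fun A =>
    fourierCoeff_tone hN1 A (by simp only [freq]; push_cast; field_simp; ring) (Or.inr (hne c1))
  have F3 : ∀ A, fourierCoeff N (tone A (freq N m₂ ν₂)) (freq N m₁ ν₁ + r / N) =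
      A * gain N ((m₂ - m₁ : ℤ) + ν₂ - ν₁ - r) := fun A =>
    fourierCoeff_tone hN1 A (by simp only [freq]; push_cast; field_simp; ring) (Or.inr (hne c2))
  have F4 : ∀ A, fourierCoeff N (tone A (freq N m₁ δ₁)) (freq N m₂ ν₂) =
      A * gain N ((m₁ - m₂ : ℤ) + δ₁ - ν₂) := fun A =>
    fourierCoeff_tone hN1 A (by simp only [freq]; push_cast; field_simp; ring) (Or.inr (hne c3))
  have F5 : ∀ A, fourierCoeff N (tone A (freq N m₁ ν₁)) (freq N m₂ ν₂) =
      A * gain N ((m₁ - m₂ : ℤ) + ν₁ - ν₂) := fun A =>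
    fourierCoeff_tone hN1 A (by simp only [freq]; push_cast; field_simp; ring) (Or.inr (hne c4))
  have F6 : ∀ A, fourierCoeff N (tone A (freq N m₂ δ₂)) (freq N m₂ ν₂) = A * gain N (δ₂ - ν₂) :=
    fun A => fourierCoeff_tone hN1 A (by simp only [freq]; field_simp; ring) (h0 hgl)
  have hsig : ∀ g, fourierCoeff N (signal A₁ A₂ (freq N m₁ δ₁) (freq N m₂ δ₂) w) g =
      fourierCoeff N (tone A₁ (freq N m₁ δ₁)) g + fourierCoeff N (tone A₂ (freq N m₂ δ₂)) g
        + fourierCoeff N w g := fun g => by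
    rw [← fourierCoeff_add, ← fourierCoeff_add]; rfl
  have hNc : (N : ℂ) ≠ 0 := by exact_mod_cast hN0
  have G2 : (1 + osc (δ₂ - ν₁)) / (1 - osc (((m₂ - m₁ : ℤ) + δ₂ - ν₁ - r) / N))
      = N * gain N ((m₂ - m₁ : ℤ) + δ₂ - ν₁ - r) := by
    have h1 := gain_mul hN1 (Or.inr (hne c1))
    rw [add_sub_assoc, osc_sub_half_int hr, ← add_sub_assoc] at h1
    rw [div_eq_iff (sub_ne_zero.2 (hne c1).symm)]
    linear_combination -h1
  have G3 : (1 + osc (ν₂ - ν₁)) / (1 - osc (((m₂ - m₁ : ℤ) + ν₂ - ν₁ - r) / N))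
      = N * gain N ((m₂ - m₁ : ℤ) + ν₂ - ν₁ - r) := by
    have h1 := gain_mul hN1 (Or.inr (hne c2))
    rw [add_sub_assoc, osc_sub_half_int hr, ← add_sub_assoc] at h1
    rw [div_eq_iff (sub_ne_zero.2 (hne c2).symm)]
    linear_combination -h1
  have hb : ∀ x : ℝ, 2 * Δ ≤ ‖1 - osc (x / N)‖ → ‖gain N x‖ ≤ 1 / Δ / N := fun x h => by
    refine (norm_gain_le_of_separated hN1 (by positivity) h).trans (le_of_eq ?_)
    field_simp
  have b1 := hb _ c1
  have b2 := hb _ c2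
  have b3 := hb _ c3
  have b4 := hb _ c4
  have b0 := norm_gain_le hN1 hgl
  rw [beta, G2, G3]
  refine ⟨?_, ?_⟩
  · rw [leakageFreeCoeff, ampEst, fourierCoeff_sub, hsig, hsig, F1, F2, F3, F4, F5, F6]
    set a := gain N ((m₂ - m₁ : ℤ) + δ₂ - ν₁ - r)
    set b := gain N ((m₂ - m₁ : ℤ) + ν₂ - ν₁ - r)
    set c := gain N ((m₁ - m₂ : ℤ) + δ₁ - ν₂)
    set e := gain N ((m₁ - m₂ : ℤ) + ν₁ - ν₂)
    set W := fourierCoeff N w (freq N m₂ ν₂)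
    set W' := fourierCoeff N w (freq N m₁ ν₁ + r / N)
    -- What the signal, the noise and β leave over is the error of the second amplitude, apart from
    -- its own gain loss, times one more cross gain `b` = O(1/N).
    have h1 : A₁ * gain N (δ₁ - ν₁ - r) + A₂ * a + W'
        - (A₁ * c + A₂ * gain N (δ₂ - ν₂) + W - B * e) * b - A₁ * gain N (δ₁ - ν₁ - r) - W'
        - 1 / N * (A₂ * (N * a - gain N (δ₂ - ν₂) * (N * b))) = b * -(W + (A₁ * c - B * e)) := by
      field_simp; ring
    rw [h1, norm_mul, norm_neg]
    gcongr
    refine (norm_add_le _ _).trans ?_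
    gcongr
    refine (norm_sub_le _ _).trans ?_
    rw [norm_mul, norm_mul, add_mul]
    gcongr
  · refine (norm_sub_le _ _).trans ?_
    rw [norm_mul, norm_mul, norm_mul, Complex.norm_natCast]
    calc _ ≤ N * (1 / Δ / N) + Real.pi / 2 * (N * (1 / Δ / N)) := by gcongr
      _ = (1 + Real.pi / 2) / Δ := by field_simp
      _ ≤ 3 / Δ := by gcongr; linarith [Real.pi_le_four]

/-! ### Uniform expansion in the noise and the amplitude estimate -/

/-- The size of the random quantities that control the remainder. -/
def noiseSize (N : ℕ) (w : ℕ → ℂ) (g₁ g₂ : ℝ) (B : ℂ) : ℝ :=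
  1 + ‖B‖ + N * (‖fourierCoeff N w (g₁ + 1 / 2 / N)‖ ^ 2
    + ‖fourierCoeff N w (g₁ + -(1 / 2) / N)‖ ^ 2 + ‖fourierCoeff N w g₂‖ ^ 2)

lemma one_le_noiseSize (N : ℕ) (w : ℕ → ℂ) (g₁ g₂ : ℝ) (B : ℂ) : 1 ≤ noiseSize N w g₁ g₂ B := by
  unfold noiseSize; rw [add_assoc]; exact le_add_of_nonneg_right (by positivity)

lemma norm_le_noiseSize (N : ℕ) (w : ℕ → ℂ) (g₁ g₂ : ℝ) (B : ℂ) : ‖B‖ ≤ noiseSize N w g₁ g₂ B := by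
  unfold noiseSize
  have : 0 ≤ (N : ℝ) * (‖fourierCoeff N w (g₁ + 1 / 2 / N)‖ ^ 2
    + ‖fourierCoeff N w (g₁ + -(1 / 2) / N)‖ ^ 2 + ‖fourierCoeff N w g₂‖ ^ 2) := by positivity
  linarith

lemma sq_norm_le_of_mul_le {N : ℕ} (hN : 1 ≤ N) {x s : ℝ} (h : N * x ^ 2 ≤ s) :
    x ^ 2 ≤ rate N ^ 2 * s := by
  have : (0 : ℝ) < N := by exact_mod_cast hN
  rw [rate_sq, one_div, inv_mul_eq_div, le_div_iff₀ this]; linarith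

lemma fourierCoeff_zero (w : ℕ → ℂ) (g : ℝ) : fourierCoeff 0 w g = 0 := by simp [fourierCoeff]

lemma sq_norm_fourierCoeff_le (N : ℕ) (w : ℕ → ℂ) (g₁ g₂ : ℝ) (B : ℂ) :
    ‖fourierCoeff N w (g₁ + 1 / 2 / N)‖ ^ 2 ≤ rate N ^ 2 * noiseSize N w g₁ g₂ B ∧
    ‖fourierCoeff N w (g₁ + -(1 / 2) / N)‖ ^ 2 ≤ rate N ^ 2 * noiseSize N w g₁ g₂ B ∧
    ‖fourierCoeff N w g₂‖ ^ 2 ≤ rate N ^ 2 * noiseSize N w g₁ g₂ B := by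
  rcases Nat.eq_zero_or_pos N with rfl | hN
  · simp [fourierCoeff_zero, rate]
  have h := fun x : ℝ => mul_nonneg (Nat.cast_nonneg (α := ℝ) N) (sq_nonneg x)
  have h1 := h ‖fourierCoeff N w (g₁ + 1 / 2 / N)‖
  have h2 := h ‖fourierCoeff N w (g₁ + -(1 / 2) / N)‖
  have h3 := h ‖fourierCoeff N w g₂‖
  have hB := norm_nonneg B
  refine ⟨?_, ?_, ?_⟩ <;> refine sq_norm_le_of_mul_le hN ?_ <;> unfold noiseSize <;>
    (rw [mul_add, mul_add]; linarith)

lemma mul_chord_sub_isBigO {ι : Type*} {l : Filter ι} {q S : ι → ℝ} (n : ι → ℕ)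
    (hn : ∀ k, ∀ᶠ i in l, k ≤ n i) (hq : ∀ i, q i ^ 2 = 1 / n i) {x : ι → ℝ} (hx : ∀ i, |x i| ≤ 3 / 2) :
    (fun i => (n i * (1 - osc (x i / n i)) + 2 * Real.pi * x i * Complex.I : ℂ))
      =O[l] weight q S 2 0 := by
  refine IsBigO.of_bound 144 ?_
  filter_upwards [hn 20] with i hi
  refine (norm_scaled_chord_le hi (hx i)).trans (le_of_eq ?_)
  rw [weight, pow_zero, mul_one, hq, Real.norm_of_nonneg (by positivity)]; ring

/-- The second-order expansion of the frequency estimate, with a remainder which is uniform in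
the noise and in the amplitude estimate. -/
theorem freqEst_expansion {Ω : Type*} (w : ℕ → Ω → ℂ) {A₁ : ℂ} (A₂ : ℂ) (hA₁ : A₁ ≠ 0)
    (m₁ m₂ : ℕ → ℤ) {δ₁ δ₂ ν₁ ν₂ : ℕ → ℝ} (hδ₁ : ∀ N, |δ₁ N| ≤ 1 / 2) (hδ₂ : ∀ N, |δ₂ N| ≤ 1 / 2)
    (hν₁ : ∀ N, |ν₁ N| ≤ 1 / 2) (hν₂ : ∀ N, |ν₂ N| ≤ 1 / 2) {Δ : ℝ} (hΔ : 0 < Δ)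
    (hsep : ∀ N, 1 ≤ N → ∀ k : ℤ, Δ ≤ |freq N (m₁ N) (δ₁ N) - freq N (m₂ N) (δ₂ N) - k|)
    (B : ℕ → Ω → ℂ) :
    ∃ C : ℝ, 0 ≤ C ∧ ∀ᶠ N in atTop, ∀ ω,
      |freqEst N (signal A₁ A₂ (freq N (m₁ N) (δ₁ N)) (freq N (m₂ N) (δ₂ N)) (fun n => w n ω))
          (m₁ N) (m₂ N) (ν₁ N) (ν₂ N) (B N ω)
        - (freq N (m₁ N) (δ₁ N)
          + bias N A₁ A₂ (m₂ N - m₁ N) (δ₁ N) (δ₂ N) (ν₁ N) (ν₂ N))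
        + 1 / (2 * Real.pi) * ((rate N : ℂ) ^ 2 *
          linTerm A₁ (δ₁ N - ν₁ N)
            (fourierCoeff N (fun n => w n ω) (freq N (m₁ N) (ν₁ N) + 1 / 2 / N))
            (fourierCoeff N (fun n => w n ω) (freq N (m₁ N) (ν₁ N) + -(1 / 2) / N))).im
        - 1 / (2 * Real.pi) * ((rate N : ℂ) ^ 2 *
          (linTerm A₁ (δ₁ N - ν₁ N)
            (fourierCoeff N (fun n => w n ω) (freq N (m₁ N) (ν₁ N) + 1 / 2 / N))
            (fourierCoeff N (fun n => w n ω) (freq N (m₁ N) (ν₁ N) + -(1 / 2) / N)) *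
          (invSlope A₁ (δ₁ N - ν₁ N) *
            (fourierCoeff N (fun n => w n ω) (freq N (m₁ N) (ν₁ N) + 1 / 2 / N)
            - fourierCoeff N (fun n => w n ω) (freq N (m₁ N) (ν₁ N) + -(1 / 2) / N))))).im|
      ≤ C * (rate N ^ 5 * noiseSize N (fun n => w n ω) (freq N (m₁ N) (ν₁ N))
          (freq N (m₂ N) (ν₂ N)) (B N ω) ^ 3) := by
  -- Big-O along this filter means one constant for all large N and all ω at once, so the
  -- deterministic order calculus yields a bound that can be integrated.
  set l : Filter (ℕ × Ω) := comap Prod.fst atTop with hl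
  have hn : ∀ k, ∀ᶠ i in l, k ≤ i.1 := fun k => tendsto_comap.eventually_ge_atTop k
  have hnR : ∀ x : ℝ, ∀ᶠ i in l, x ≤ i.1 := fun x =>
    (tendsto_natCast_atTop_atTop.comp tendsto_comap).eventually_ge_atTop x
  set q : ℕ × Ω → ℝ := fun i => rate i.1 with hq
  have hqsq : ∀ i, q i ^ 2 = 1 / i.1 := fun i => rate_sq i.1
  have hq0 : ∀ i, 0 ≤ q i := fun i => rate_nonneg _
  have hq1 : ∀ i, q i ≤ 1 := fun i => rate_le_one _
  set g₁ : ℕ → ℝ := fun N => freq N (m₁ N) (ν₁ N) with hg₁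
  set g₂ : ℕ → ℝ := fun N => freq N (m₂ N) (ν₂ N) with hg₂
  set S : ℕ × Ω → ℝ := fun i => noiseSize i.1 (fun n => w n i.2) (g₁ i.1) (g₂ i.1) (B i.1 i.2) with hS
  have hS1 : ∀ i, 1 ≤ S i := fun i => one_le_noiseSize _ _ _ _ _
  set d : ℕ → ℝ := fun N => δ₁ N - ν₁ N with hd_def
  have hd : ∀ N, |d N| ≤ 1 := fun N => by
    have h1 := abs_le.1 (hδ₁ N)
    have h2 := abs_le.1 (hν₁ N)
    simp only [hd_def]
    exact abs_le.2 ⟨by linarith, by linarith⟩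
  have hA' : 0 < ‖A₁‖ := norm_pos_iff.2 hA₁
  set x : ℕ × Ω → ℕ → ℂ := fun i => signal A₁ A₂ (freq i.1 (m₁ i.1) (δ₁ i.1))
    (freq i.1 (m₂ i.1) (δ₂ i.1)) (fun n => w n i.2) with hx
  set co : ℝ → ℕ × Ω → ℂ := fun r i => leakageFreeCoeff i.1 (x i) (g₁ i.1)
    (ampEst i.1 (x i) (g₂ i.1) (B i.1 i.2) (g₁ i.1)) (g₂ i.1) r with hco
  set W : ℝ → ℕ × Ω → ℂ := fun r i => fourierCoeff i.1 (fun n => w n i.2) (g₁ i.1 + r / i.1) with hW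
  set b : ℝ → ℕ × Ω → ℂ := fun r i => A₂ * beta i.1 (m₂ i.1 - m₁ i.1) (δ₂ i.1) (ν₁ i.1) (ν₂ i.1) r
    with hb
  set a : ℝ → ℕ × Ω → ℂ := fun r i => A₁ * gain i.1 (d i.1 - r) with ha
  set D : ℕ × Ω → ℂ := fun i => invSlope A₁ (d i.1) with hD
  set E : ℕ × Ω → ℂ := fun i => (A₁ * gain i.1 (d i.1 - 1 / 2) - A₁ * gain i.1 (d i.1 + 1 / 2))⁻¹
    with hE
  -- `u` and `v` are the limits of `u'` and `v'`: N times the chord at x/N tends to -2πjx, here with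
  -- x = d ∓ 1/2.
  set u : ℕ × Ω → ℂ := fun i => -(Real.pi * Complex.I) * (1 - 2 * d i.1) with hu
  set v : ℕ × Ω → ℂ := fun i => -(Real.pi * Complex.I) * (1 + 2 * d i.1) with hv
  set u' : ℕ × Ω → ℂ := fun i => -(i.1 * (1 - osc ((d i.1 - 1 / 2) / i.1))) with hu'
  set v' : ℕ × Ω → ℂ := fun i => i.1 * (1 - osc ((d i.1 + 1 / 2) / i.1)) with hv'
  have bd : ∀ {f : ℕ × Ω → ℂ} (c : ℝ), (∀ᶠ i in l, ‖f i‖ ≤ c) → f =O[l] weight q S 0 0 :=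
    fun c h => IsBigO.of_bound c (h.mono fun i hi => by simpa [weight] using hi)
  have huO : u =O[l] weight q S 0 0 := by
    refine bd (4 * 3) (Eventually.of_forall fun i => ?_)
    simp only [hu, norm_mul, norm_neg, Complex.norm_I, mul_one, Complex.norm_real,
      Real.norm_of_nonneg Real.pi_pos.le]
    have : ‖(1 - 2 * d i.1 : ℂ)‖ ≤ 3 := by
      refine (norm_sub_le _ _).trans ?_
      rw [norm_one, norm_mul, Complex.norm_real, Complex.norm_ofNat, Real.norm_eq_abs]
      linarith [hd i.1]
    gcongr
    exact Real.pi_le_four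
  have hvO : v =O[l] weight q S 0 0 := by
    refine bd (4 * 3) (Eventually.of_forall fun i => ?_)
    simp only [hv, norm_mul, norm_neg, Complex.norm_I, mul_one, Complex.norm_real,
      Real.norm_of_nonneg Real.pi_pos.le]
    have : ‖(1 + 2 * d i.1 : ℂ)‖ ≤ 3 := by
      refine (norm_add_le _ _).trans ?_
      rw [norm_one, norm_mul, Complex.norm_real, Complex.norm_ofNat, Real.norm_eq_abs]
      linarith [hd i.1]
    gcongr
    exact Real.pi_le_four
  have hDO : D =O[l] weight q S 0 0 :=
    bd (3 / ‖A₁‖) (Eventually.of_forall fun i => norm_invSlope_le A₁ (hd i.1))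
  have hEO : E =O[l] weight q S 0 0 := by
    refine bd (6 / ‖A₁‖) ?_
    filter_upwards [hn 180] with i hi
    exact (slope_estimate hA₁ hi (hd i.1)).2.1
  have hED : (fun i => E i - D i) =O[l] weight q S 2 0 := by
    refine IsBigO.of_bound (540 / ‖A₁‖) ?_
    filter_upwards [hn 180] with i hi
    refine (slope_estimate hA₁ hi (hd i.1)).2.2.trans (le_of_eq ?_)
    rw [weight, pow_zero, mul_one, hqsq, Real.norm_of_nonneg (by positivity)]; ring
  have hdm : ∀ i : ℕ × Ω, |d i.1 - 1 / 2| ≤ 3 / 2 := fun i => by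
    have := abs_le.1 (hd i.1); exact abs_le.2 ⟨by linarith, by linarith⟩
  have hdp : ∀ i : ℕ × Ω, |d i.1 + 1 / 2| ≤ 3 / 2 := fun i => by
    have := abs_le.1 (hd i.1); exact abs_le.2 ⟨by linarith, by linarith⟩
  have huu : (fun i => u' i - u i) =O[l] weight q S 2 0 := by
    refine (mul_chord_sub_isBigO Prod.fst hn hqsq hdm).neg_left.congr_left fun i => ?_
    simp only [hu, hu']; push_cast; ring
  have hvv : (fun i => v' i - v i) =O[l] weight q S 2 0 := by
    refine (mul_chord_sub_isBigO Prod.fst hn hqsq hdp).congr_left fun i => ?_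
    simp only [hv, hv']; push_cast; ring
  have hp : (fun i => u' i * E i - u i * D i) =O[l] weight q S 2 0 := by
    have h1 := isBigO_weight_mul huu hEO
    have h2 := isBigO_weight_mul huO hED
    exact (h1.add h2).congr_left fun i => by ring
  have hp' : (fun i => v' i * E i - v i * D i) =O[l] weight q S 2 0 := by
    have h1 := isBigO_weight_mul hvv hEO
    have h2 := isBigO_weight_mul hvO hED
    exact (h1.add h2).congr_left fun i => by ring
  have hdec : ∀ᶠ i in l, ∀ r : ℝ, r = 1 / 2 ∨ r = -(1 / 2) →
      ‖co r i - a r i - W r i - 1 / i.1 * b r i‖ ≤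
        (1 / Δ / i.1) * (‖fourierCoeff i.1 (fun n => w n i.2) (g₂ i.1)‖
          + (‖A₁‖ + ‖B i.1 i.2‖) * (1 / Δ / i.1)) ∧
      ‖beta i.1 (m₂ i.1 - m₁ i.1) (δ₂ i.1) (ν₁ i.1) (ν₂ i.1) r‖ ≤ 3 / Δ := by
    filter_upwards [hn 4, hnR (5 / Δ)] with i h4 hi r hr
    exact leakageFreeCoeff_decomposition h4 hΔ hi (hδ₁ _) (hδ₂ _) (hν₁ _) (hν₂ _)
      (hsep i.1 (by omega)) A₁ A₂ (B i.1 i.2) (fun n => w n i.2) hr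
  have hbO : ∀ r : ℝ, r = 1 / 2 ∨ r = -(1 / 2) → b r =O[l] weight q S 0 0 := fun r hr => by
    refine bd (‖A₂‖ * (3 / Δ)) ?_
    filter_upwards [hdec] with i hi
    simp only [hb, norm_mul]
    gcongr
    exact (hi r hr).2
  set η : ℝ → ℕ × Ω → ℂ := fun r i => co r i - a r i - W r i - (q i : ℂ) ^ 2 * b r i with hη
  have hηO : ∀ r : ℝ, r = 1 / 2 ∨ r = -(1 / 2) → η r =O[l] weight q S 3 1 := fun r hr => by
    refine IsBigO.of_bound (1 / Δ * (1 + (‖A₁‖ + 1) * (1 / Δ))) ?_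
    filter_upwards [hdec] with i hi
    have hqc : (q i : ℂ) ^ 2 = 1 / i.1 := by
      have := congrArg (fun t : ℝ => (t : ℂ)) (hqsq i)
      push_cast at this; exact this
    have h0 := hq0 i
    have hS0 : 0 ≤ S i := zero_le_one.trans (hS1 i)
    have hWS : ‖fourierCoeff i.1 (fun n => w n i.2) (g₂ i.1)‖ ≤ q i * S i := by
      refine abs_le_of_sq_le_sq' ?_ (by positivity) |>.2
      refine (sq_norm_fourierCoeff_le i.1 (fun n => w n i.2) (g₁ i.1) (g₂ i.1) (B i.1 i.2)).2.2.trans ?_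
      rw [mul_pow]
      refine mul_le_mul_of_nonneg_left ?_ (by positivity)
      exact le_self_pow₀ (hS1 i) two_ne_zero
    have hBS : ‖A₁‖ + ‖B i.1 i.2‖ ≤ (‖A₁‖ + 1) * S i := by
      have h1 : ‖B i.1 i.2‖ ≤ S i := norm_le_noiseSize _ _ _ _ _
      have h2 := mul_le_mul_of_nonneg_left (hS1 i) hA'.le
      linarith
    simp only [hη, hqc]
    refine (hi r hr).1.trans ?_
    have hN : 1 / Δ / (i.1 : ℝ) = 1 / Δ * q i ^ 2 := by rw [hqsq]; ring
    rw [hN, Real.norm_of_nonneg (by unfold weight; positivity), weight, pow_one]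
    calc 1 / Δ * q i ^ 2 * (‖fourierCoeff i.1 (fun n => w n i.2) (g₂ i.1)‖
          + (‖A₁‖ + ‖B i.1 i.2‖) * (1 / Δ * q i ^ 2))
        ≤ 1 / Δ * q i ^ 2 * (q i * S i + ((‖A₁‖ + 1) * S i) * (1 / Δ * q i)) := by
          gcongr
          exact pow_le_of_le_one h0 (hq1 i) two_ne_zero
      _ = _ := by ring
  have hεd : ∀ r i, co r i - a r i = W r i + (q i : ℂ) ^ 2 * b r i + η r i := fun r i => by
    simp only [hη]; ring
  have hWS : ∀ i, ‖W (1 / 2) i‖ ^ 2 ≤ q i ^ 2 * S i := fun i =>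
    (sq_norm_fourierCoeff_le i.1 (fun n => w n i.2) (g₁ i.1) (g₂ i.1) (B i.1 i.2)).1
  have hWS' : ∀ i, ‖W (-(1 / 2)) i‖ ^ 2 ≤ q i ^ 2 * S i := fun i =>
    (sq_norm_fourierCoeff_le i.1 (fun n => w n i.2) (g₁ i.1) (g₂ i.1) (B i.1 i.2)).2.1
  set F : ℕ × Ω → ℝ := fun i => freqEst i.1 (x i) (m₁ i.1) (m₂ i.1) (ν₁ i.1) (ν₂ i.1) (B i.1 i.2)
    - freq i.1 (m₁ i.1) (δ₁ i.1) with hF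
  have hFeq : ∀ i, F i = (residualEst i.1 (co (1 / 2) i) (co (-(1 / 2)) i) - d i.1) / i.1 := fun i => by
    simp only [hF, freqEst, freq, hd_def, hco, hg₁, hg₂]; ring
  have hF1 : F =O[l] weight q S 0 0 := by
    refine IsBigO.of_bound 2 ?_
    filter_upwards [hn 1] with i hi
    have hN : (1 : ℝ) ≤ i.1 := by exact_mod_cast hi
    simp only [weight, pow_zero, mul_one, norm_one]
    rw [hFeq, Real.norm_eq_abs, abs_div, Nat.abs_cast, div_le_iff₀ (by linarith)]
    refine (abs_sub _ _).trans ?_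
    linarith [abs_residualEst_le i.1 (co (1 / 2) i) (co (-(1 / 2)) i), hd i.1]
  set γ : ℕ × Ω → ℂ := fun i => (q i : ℂ) ^ 2 * (u' i * E i * (co (1 / 2) i - a (1 / 2) i)
    + v' i * E i * (co (-(1 / 2)) i - a (-(1 / 2)) i)) /
      (1 + E i * ((co (1 / 2) i - a (1 / 2) i) - (co (-(1 / 2)) i - a (-(1 / 2)) i))) with hγ
  have hFγ : ∀ᶠ i in l,
      ‖E i * ((co (1 / 2) i - a (1 / 2) i) - (co (-(1 / 2)) i - a (-(1 / 2)) i))‖ ≤ 1 / 2 →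
      ‖γ i‖ ≤ 1 / 2 → F i = -(1 / (2 * Real.pi)) * (Complex.log (1 + γ i)).im := by
    filter_upwards [hn 180] with i hi h1 h2
    have hN : (180 : ℝ) ≤ i.1 := by exact_mod_cast hi
    have hN0 : (i.1 : ℂ) ≠ 0 := by exact_mod_cast (by omega : i.1 ≠ 0)
    obtain ⟨hs, -, -⟩ := slope_estimate hA₁ hi (hd i.1)
    have ha' : a (-(1 / 2)) i = A₁ * gain i.1 (d i.1 + 1 / 2) := by
      simp only [ha]; rw [sub_neg_eq_add]
    have e1 := gain_mul_of_abs_lt (N := i.1) (by omega) (x := d i.1 - 1 / 2) (by linarith [hdm i])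
    have e2 := gain_mul_of_abs_lt (N := i.1) (by omega) (x := d i.1 + 1 / 2) (by linarith [hdp i])
    rw [osc_sub_half] at e1
    rw [osc_add_half] at e2
    have hE' : E i = (a (1 / 2) i - a (-(1 / 2)) i)⁻¹ := by rw [ha']
    have hs' : a (1 / 2) i - a (-(1 / 2)) i ≠ 0 := by rw [ha']; exact hs
    have h0 : (1 - osc ((d i.1 - 1 / 2) / i.1)) * a (1 / 2) i =
        (1 - osc ((d i.1 + 1 / 2) / i.1)) * a (-(1 / 2)) i := by
      rw [ha']
      refine mul_left_cancel₀ hN0 ?_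
      simp only [ha]
      linear_combination A₁ * e1 - A₁ * e2
    have hqc : (q i : ℂ) ^ 2 = 1 / i.1 := by
      have := congrArg (fun t : ℝ => (t : ℂ)) (hqsq i)
      push_cast at this; exact this
    rw [hE'] at h1
    have hres := residualEst_perturbed (N := i.1) (by omega) (hd i.1) hs' h0 h1 h2 (by
      simp only [hγ]
      rw [hqc, hE']
      congr 1
      simp only [hu', hv']
      field_simp)
    rw [add_sub_cancel, add_sub_cancel] at hres
    rw [hFeq, hres]
    field_simp
    ring
  have key := log_remainder_isBigO hq0 hq1 hS1 (isBigO_weight_mul huO hDO) (isBigO_weight_mul hvO hDO)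
    hDO hp hp' hED hWS hWS' (hbO _ (Or.inl rfl)) (hbO _ (Or.inr rfl)) (hηO _ (Or.inl rfl))
    (hηO _ (Or.inr rfl)) (hεd (1 / 2)) (hεd (-(1 / 2))) (γ := γ) (fun i => rfl) hF1 hFγ
  obtain ⟨C, hC, hCb⟩ := key.exists_nonneg
  refine ⟨C, hC, ?_⟩
  have hev := hCb.bound
  rw [hl, eventually_comap] at hev
  filter_upwards [hev] with N hN ω
  have h := hN (N, ω) rfl
  have hS0 : 0 ≤ S (N, ω) := zero_le_one.trans (hS1 _)
  have hq0' := hq0 (N, ω)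
  rw [Real.norm_of_nonneg (by unfold weight; positivity : 0 ≤ weight q S 5 3 (N, ω)), weight,
    Real.norm_eq_abs] at h
  refine le_trans (le_of_eq ?_) h
  congr 1
  rw [bias_eq]
  simp only [linTerm, hF, hu, hv, hD, hW, hb, hq, hx, hg₁, hd_def]
  simp only [mul_add, mul_sub, Complex.add_im, Complex.sub_im]
  ring

/-! ### Linear combinations of the noise -/

lemma map_sum_smul_eq_gaussianReal {Ω ι : Type*} [MeasurableSpace Ω] {P : Measure Ω}
    [IsProbabilityMeasure P] {X : ι → Ω → ℝ} (hX : ∀ i, Measurable (X i)) (hind : iIndepFun X P)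
    {v : NNReal} (hlaw : ∀ i, P.map (X i) = gaussianReal 0 v) (c : ι → ℝ) (s : Finset ι) :
    P.map (∑ i ∈ s, fun ω => c i * X i ω) = gaussianReal 0 (∑ i ∈ s, Real.toNNReal (c i ^ 2) * v) := by
  classical
  induction s using Finset.induction_on with
  | empty =>
    simp only [Finset.sum_empty, gaussianReal_zero_var]
    exact (Measure.map_const P (0 : ℝ)).trans (by simp)
  | insert i s hi ih =>
    have hc : ∀ i, Measurable (fun ω => c i * X i ω) := fun i => (hX i).const_mul _
    have hind' : iIndepFun (fun i ω => c i * X i ω) P :=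
      hind.comp (fun i x => c i * x) fun i => measurable_const_mul _
    have h1 := hind'.indepFun_finsetSum_of_notMem hc hi
    have h2 : P.map (fun ω => c i * X i ω) = gaussianReal 0 (Real.toNNReal (c i ^ 2) * v) := by
      have := gaussianReal_map_const_mul (μ := 0) (v := v) (c i)
      rw [← hlaw i, Measure.map_map (measurable_const_mul _) (hX i), mul_zero] at this
      refine Eq.trans ?_ (this.trans ?_)
      · rfl
      · congr 2
        ext; simp [Real.coe_toNNReal _ (sq_nonneg (c i))]
    have h3 := gaussianReal_add_gaussianReal_of_indepFun h1 ih h2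
    rw [Finset.sum_insert hi, Finset.sum_insert hi, add_comm, h3, add_zero, add_comm]

lemma memLp_of_map_gaussianReal {Ω : Type*} [MeasurableSpace Ω] {P : Measure Ω} {Y : Ω → ℝ} (hY : Measurable Y) {v : NNReal}
    (h : P.map Y = gaussianReal 0 v) (p : NNReal) : MemLp Y p P := by
  have h1 : MemLp id (p : ENNReal) (P.map Y) := by rw [h]; exact memLp_id_gaussianReal p
  exact (memLp_map_measure_iff aestronglyMeasurable_id hY.aemeasurable).1 h1

lemma integral_eq_zero_of_map_gaussianReal {Ω : Type*} [MeasurableSpace Ω] {P : Measure Ω} {Y : Ω → ℝ} (hY : Measurable Y) {v : NNReal}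
    (h : P.map Y = gaussianReal 0 v) : ∫ ω, Y ω ∂P = 0 := by
  have h1 := integral_map (μ := P) hY.aemeasurable (f := id) aestronglyMeasurable_id
  rw [h] at h1
  simpa using h1.symm

lemma integral_pow_of_map_gaussianReal {Ω : Type*} [MeasurableSpace Ω] {P : Measure Ω} {Y : Ω → ℝ} (hY : Measurable Y) {v : NNReal}
    (h : P.map Y = gaussianReal 0 v) (k : ℕ) : ∫ ω, Y ω ^ k ∂P = ∫ x, x ^ k ∂(gaussianReal 0 v) := by
  have h1 := integral_map (μ := P) hY.aemeasurable (f := fun x => x ^ k) (by fun_prop)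
  rw [h] at h1
  exact h1.symm

lemma integrable_pow_of_map_gaussianReal {Ω : Type*} [MeasurableSpace Ω] {P : Measure Ω}
    [IsProbabilityMeasure P] {Y : Ω → ℝ} (hY : Measurable Y) {v : NNReal}
    (h : P.map Y = gaussianReal 0 v) (k : ℕ) : Integrable (fun ω => Y ω ^ k) P := by
  have h1 := memLp_of_map_gaussianReal hY h k
  have h2 : Integrable (fun ω => ‖Y ω‖ ^ k) P := by
    have := h1.integrable_norm_rpow'
    simpa using this
  refine h2.mono' (by fun_prop) (Eventually.of_forall fun ω => ?_)
  rw [norm_pow]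

lemma IsComplexWhiteGaussian.measurable_sum {Ω : Type*} [MeasurableSpace Ω] {P : Measure Ω}
    {w : ℕ → Ω → ℂ} {σ : ℝ} (hw : IsComplexWhiteGaussian P w σ) (N : ℕ) (c : ℕ → ℂ) :
    Measurable (fun ω => ∑ n ∈ Finset.range N, c n * w n ω) :=
  Finset.measurable_sum _ fun n _ => (hw.measurable n).const_mul _

section Noise

variable {Ω : Type*} [MeasurableSpace Ω] {P : Measure Ω} [IsProbabilityMeasure P] {w : ℕ → Ω → ℂ}
  {σ : ℝ}

/-- Re(c w) = Re c Re w - Im c Im w is a combination of independent real Gaussians of equal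
variance. Real parts suffice, since rotating `c` by a unit gives every other component. -/
lemma IsComplexWhiteGaussian.map_re_sum (hw : IsComplexWhiteGaussian P w σ) (N : ℕ) (c : ℕ → ℂ) :
    P.map (fun ω => (∑ n ∈ Finset.range N, c n * w n ω).re) =
      gaussianReal 0 (Real.toNNReal (σ ^ 2 / 2 * ∑ n ∈ Finset.range N, ‖c n‖ ^ 2)) := by
  set X : ℕ × Bool → Ω → ℝ := fun i ω => if i.2 then (w i.1 ω).re else (w i.1 ω).im with hX
  have hXm : ∀ i, Measurable (X i) := by
    rintro ⟨n, b⟩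
    cases b
    · exact Complex.measurable_im.comp (hw.measurable n)
    · exact Complex.measurable_re.comp (hw.measurable n)
  have hlaw : ∀ i, P.map (X i) = gaussianReal 0 (Real.toNNReal (σ ^ 2 / 2)) := by
    rintro ⟨n, b⟩
    cases b
    · exact hw.map_im n
    · exact hw.map_re n
  have h := map_sum_smul_eq_gaussianReal hXm hw.indep hlaw
    (fun i => if i.2 then (c i.1).re else -(c i.1).im) (Finset.range N ×ˢ Finset.univ)
  have e1 : (∑ i ∈ Finset.range N ×ˢ (Finset.univ : Finset Bool),
      fun ω => (if i.2 then (c i.1).re else -(c i.1).im) * X i ω) =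
      fun ω => (∑ n ∈ Finset.range N, c n * w n ω).re := by
    ext ω
    rw [Finset.sum_product, Finset.sum_apply, Complex.re_sum]
    refine Finset.sum_congr rfl fun n _ => ?_
    rw [Finset.sum_apply]
    simp [hX, Complex.mul_re]
    ring
  have e2 : (∑ i ∈ Finset.range N ×ˢ (Finset.univ : Finset Bool),
      Real.toNNReal ((if i.2 then (c i.1).re else -(c i.1).im) ^ 2) * Real.toNNReal (σ ^ 2 / 2)) =
      Real.toNNReal (σ ^ 2 / 2 * ∑ n ∈ Finset.range N, ‖c n‖ ^ 2) := by
    rw [Finset.sum_product, Real.toNNReal_mul (by positivity), mul_comm,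
      Real.toNNReal_sum_of_nonneg fun n _ => by positivity, Finset.sum_mul]
    refine Finset.sum_congr rfl fun n _ => ?_
    rw [← Finset.sum_mul]
    congr 1
    simp only [Fintype.sum_bool, if_true, Bool.false_eq_true, if_false]
    rw [← Real.toNNReal_add (sq_nonneg _) (sq_nonneg _), Complex.sq_norm, Complex.normSq_apply]
    congr 1; ring
  rwa [e1, e2] at h

/-- The noise is circular: products of linear combinations have mean zero. -/
lemma IsComplexWhiteGaussian.integral_im_sq (hw : IsComplexWhiteGaussian P w σ) (N : ℕ) (c : ℕ → ℂ) :
    Integrable (fun ω => ((∑ n ∈ Finset.range N, c n * w n ω) ^ 2).im) P ∧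
    ∫ ω, ((∑ n ∈ Finset.range N, c n * w n ω) ^ 2).im ∂P = 0 := by
  have hm := fun θ : ℂ => Complex.measurable_re.comp (hw.measurable_sum N fun n => θ * c n)
  -- Im z² = ½((Re (1-j)z)² - (Re (1+j)z)²), and the two real parts have the same law because |1-j|
  -- = |1+j|.
  have h1 := hw.map_re_sum N fun n => (1 - Complex.I) * c n
  have h2 := hw.map_re_sum N fun n => (1 + Complex.I) * c n
  have i1 := integrable_pow_of_map_gaussianReal (hm _) h1 2
  have i2 := integrable_pow_of_map_gaussianReal (hm _) h2 2
  have e1 := integral_pow_of_map_gaussianReal (hm _) h1 2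
  have e2 := integral_pow_of_map_gaussianReal (hm _) h2 2
  simp only [Function.comp_apply] at i1 i2 e1 e2
  have hn : ‖(1 - Complex.I : ℂ)‖ = ‖(1 + Complex.I : ℂ)‖ := by
    simp [Complex.norm_def, Complex.normSq_apply]
  simp only [norm_mul, hn] at e1
  simp only [norm_mul] at e2
  have hfun : (fun ω => ((∑ n ∈ Finset.range N, c n * w n ω) ^ 2).im) = fun ω =>
      (1 / 2) * ((∑ n ∈ Finset.range N, (1 - Complex.I) * c n * w n ω).re ^ 2
        - (∑ n ∈ Finset.range N, (1 + Complex.I) * c n * w n ω).re ^ 2) := by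
    ext ω
    simp only [mul_assoc, ← Finset.mul_sum]
    set z := ∑ n ∈ Finset.range N, c n * w n ω
    simp [pow_two, Complex.mul_re, Complex.mul_im]
    ring
  rw [hfun]
  refine ⟨(i1.sub i2).const_mul _, ?_⟩
  rw [integral_const_mul, integral_sub i1 i2]
  rw [e1, e2, sub_self, mul_zero]

/-- Polarisation of the circularity of squares. It removes the quadratic noise term from the mean,
where that term would compete with the bias. -/
lemma IsComplexWhiteGaussian.integral_im_mul (hw : IsComplexWhiteGaussian P w σ) (N : ℕ)
    (c d : ℕ → ℂ) :
    Integrable (fun ω => ((∑ n ∈ Finset.range N, c n * w n ω) *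
      (∑ n ∈ Finset.range N, d n * w n ω)).im) P ∧
    ∫ ω, ((∑ n ∈ Finset.range N, c n * w n ω) * (∑ n ∈ Finset.range N, d n * w n ω)).im ∂P = 0 := by
  obtain ⟨i1, e1⟩ := hw.integral_im_sq N fun n => c n + d n
  obtain ⟨i2, e2⟩ := hw.integral_im_sq N fun n => c n - d n
  have hfun : (fun ω => ((∑ n ∈ Finset.range N, c n * w n ω) *
      (∑ n ∈ Finset.range N, d n * w n ω)).im) = fun ω =>
      (1 / 4) * (((∑ n ∈ Finset.range N, (c n + d n) * w n ω) ^ 2).im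
        - ((∑ n ∈ Finset.range N, (c n - d n) * w n ω) ^ 2).im) := by
    ext ω
    simp only [add_mul, sub_mul, Finset.sum_add_distrib, Finset.sum_sub_distrib]
    simp [pow_two, Complex.mul_im]
    ring
  rw [hfun]
  refine ⟨(i1.sub i2).const_mul _, ?_⟩
  rw [integral_const_mul, integral_sub i1 i2, e1, e2, sub_self, mul_zero]

lemma IsComplexWhiteGaussian.integral_im (hw : IsComplexWhiteGaussian P w σ) (N : ℕ) (c : ℕ → ℂ) :
    Integrable (fun ω => (∑ n ∈ Finset.range N, c n * w n ω).im) P ∧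
    ∫ ω, (∑ n ∈ Finset.range N, c n * w n ω).im ∂P = 0 := by
  have hfun : (fun ω => (∑ n ∈ Finset.range N, c n * w n ω).im) =
      fun ω => (∑ n ∈ Finset.range N, (-Complex.I * c n) * w n ω).re := by
    ext ω
    simp only [mul_assoc, ← Finset.mul_sum]
    simp
  have hm := Complex.measurable_re.comp (hw.measurable_sum N fun n => -Complex.I * c n)
  have hl := hw.map_re_sum N fun n => -Complex.I * c n
  rw [hfun]
  exact ⟨(memLp_of_map_gaussianReal hm hl 1).integrable (by simp),
    integral_eq_zero_of_map_gaussianReal hm hl⟩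

end Noise

/-! ### Moment bounds for the noise coefficients -/

lemma fourierCoeff_eq_sum (N : ℕ) (x : ℕ → ℂ) (g : ℝ) :
    fourierCoeff N x g = ∑ n ∈ Finset.range N, (1 / N * osc (-(g * n))) * x n := by
  rw [fourierCoeff, Finset.mul_sum]
  exact Finset.sum_congr rfl fun n _ => by ring

/-- For N ≥ 1 both real forms have coefficient vectors of unit length, so under the noise each has a
law free of N and g; uniform moment bounds follow. -/
lemma natCast_mul_sq_norm_fourierCoeff (N : ℕ) (x : ℕ → ℂ) (g : ℝ) :
    N * ‖fourierCoeff N x g‖ ^ 2 =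
      (∑ n ∈ Finset.range N, (rate N * osc (-(g * n))) * x n).re ^ 2 +
      (∑ n ∈ Finset.range N, (-Complex.I * (rate N * osc (-(g * n)))) * x n).re ^ 2 := by
  simp only [mul_assoc, ← Finset.mul_sum, fourierCoeff]
  have hc : ∀ n, x n * osc (-(g * n)) = osc (-(g * n)) * x n := fun n => mul_comm _ _
  simp only [hc]
  set z := ∑ n ∈ Finset.range N, osc (-(g * n)) * x n
  rcases Nat.eq_zero_or_pos N with hN | hN
  · simp [hN, rate]
  have hN' : (0 : ℝ) < N := by exact_mod_cast hN
  have h1 : (rate N * z : ℂ).re = rate N * z.re := Complex.re_ofReal_mul _ _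
  have h2 : (-Complex.I * (rate N * z) : ℂ).re = rate N * z.im := by simp
  rw [h1, h2, mul_pow, mul_pow, rate_sq, norm_mul, mul_pow, Complex.sq_norm z, Complex.normSq_apply]
  simp
  field_simp

/-- Repeated use of (x + y)³ ≤ 4(x³ + y³): two levels for a and b give 16, and at most four levels
for the squares give 256. -/
lemma cube_sum_le {a b y₁ z₁ y₂ z₂ y₃ z₃ : ℝ} (ha : 0 ≤ a) (hb : 0 ≤ b) :
    (a + b + ((y₁ ^ 2 + z₁ ^ 2) + (y₂ ^ 2 + z₂ ^ 2) + (y₃ ^ 2 + z₃ ^ 2))) ^ 3 ≤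
      16 * (a ^ 3 + b ^ 3) + 256 * ((y₁ ^ 6 + z₁ ^ 6) + (y₂ ^ 6 + z₂ ^ 6) + (y₃ ^ 6 + z₃ ^ 6)) := by
  have h : ∀ {x y : ℝ}, 0 ≤ x → 0 ≤ y → (x + y) ^ 3 ≤ 4 * (x ^ 3 + y ^ 3) := fun hx hy => by
    have := add_pow_le hx hy 3
    norm_num at this
    exact this
  have h1 := h (sq_nonneg y₁) (sq_nonneg z₁)
  have h2 := h (sq_nonneg y₂) (sq_nonneg z₂)
  have h3 := h (sq_nonneg y₃) (sq_nonneg z₃)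
  have h4 := h (add_nonneg (sq_nonneg y₁) (sq_nonneg z₁)) (add_nonneg (sq_nonneg y₂) (sq_nonneg z₂))
  have h5 := h (add_nonneg (add_nonneg (sq_nonneg y₁) (sq_nonneg z₁))
    (add_nonneg (sq_nonneg y₂) (sq_nonneg z₂))) (add_nonneg (sq_nonneg y₃) (sq_nonneg z₃))
  have h6 := h ha hb
  have h7 := h (add_nonneg ha hb) (add_nonneg (add_nonneg (add_nonneg (sq_nonneg y₁) (sq_nonneg z₁))
    (add_nonneg (sq_nonneg y₂) (sq_nonneg z₂))) (add_nonneg (sq_nonneg y₃) (sq_nonneg z₃)))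
  simp only [← pow_mul] at h1 h2 h3
  norm_num at h1 h2 h3
  have p3 : 0 ≤ y₃ ^ 6 + z₃ ^ 6 := by positivity
  nlinarith

lemma integral_norm_cube_le {Ω : Type*} [MeasurableSpace Ω] {P : Measure Ω} {f : Ω → ℂ}
    (hf : Measurable f) {C : NNReal} (hC : eLpNorm f 3 P ≤ C) :
    Integrable (fun ω => ‖f ω‖ ^ 3) P ∧ ∫ ω, ‖f ω‖ ^ 3 ∂P ≤ C ^ 3 := by
  have hm : MemLp f 3 P := ⟨hf.aestronglyMeasurable, hC.trans_lt ENNReal.coe_lt_top⟩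
  have hI : Integrable (fun ω => ‖f ω‖ ^ 3) P := by
    have := hm.integrable_norm_rpow (by norm_num) (by norm_num)
    refine this.congr (Eventually.of_forall fun ω => ?_)
    simp only [ENNReal.toReal_ofNat]
    exact_mod_cast Real.rpow_natCast ‖f ω‖ 3
  refine ⟨hI, ?_⟩
  have h := hm.eLpNorm_eq_integral_rpow_norm (by norm_num) (by norm_num)
  have h3 : (fun ω => ‖f ω‖ ^ (3 : ENNReal).toReal) = fun ω => ‖f ω‖ ^ 3 := by
    ext ω
    simp only [ENNReal.toReal_ofNat]
    exact_mod_cast Real.rpow_natCast ‖f ω‖ 3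
  rw [h3] at h
  have h0 : 0 ≤ ∫ ω, ‖f ω‖ ^ 3 ∂P := integral_nonneg fun ω => by positivity
  rw [h, ← ENNReal.ofReal_coe_nnreal, ENNReal.ofReal_le_ofReal_iff C.coe_nonneg] at hC
  have h4 := pow_le_pow_left₀ (by positivity) hC 3
  rw [ENNReal.toReal_ofNat, ← Real.rpow_natCast, ← Real.rpow_mul h0] at h4
  norm_num at h4
  exact h4

section Noise

variable {Ω : Type*} [MeasurableSpace Ω] {P : Measure Ω} [IsProbabilityMeasure P] {w : ℕ → Ω → ℂ}
  {σ : ℝ}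

lemma IsComplexWhiteGaussian.map_re_unit_sum (hw : IsComplexWhiteGaussian P w σ) {N : ℕ}
    (hN : 1 ≤ N) (g : ℝ) {θ : ℂ} (hθ : ‖θ‖ = 1) :
    P.map (fun ω => (∑ n ∈ Finset.range N, (θ * (rate N * osc (-(g * n)))) * w n ω).re) =
      gaussianReal 0 (Real.toNNReal (σ ^ 2 / 2)) := by
  rw [hw.map_re_sum]
  congr 2
  have hN' : (N : ℝ) ≠ 0 := by exact_mod_cast (by omega : N ≠ 0)
  have : ∀ n : ℕ, ‖θ * (rate N * osc (-(g * n)))‖ ^ 2 = 1 / N := fun n => by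
    rw [norm_mul, norm_mul, hθ, norm_osc, one_mul, mul_one, Complex.norm_real,
      Real.norm_of_nonneg (rate_nonneg N), rate_sq]
  simp only [this, Finset.sum_const, Finset.card_range, nsmul_eq_mul]
  field_simp

/-- The random variables controlling the remainder are bounded in `L³`. -/
lemma IsComplexWhiteGaussian.integral_noiseSize_le (hw : IsComplexWhiteGaussian P w σ) (C : NNReal) :
    ∃ K : ℝ, 0 ≤ K ∧ ∀ N, 1 ≤ N → ∀ (g₁ g₂ : ℝ) (B : Ω → ℂ), Measurable B → eLpNorm B 3 P ≤ C →
      Integrable (fun ω => noiseSize N (fun n => w n ω) g₁ g₂ (B ω) ^ 3) P ∧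
      ∫ ω, noiseSize N (fun n => w n ω) g₁ g₂ (B ω) ^ 3 ∂P ≤ K := by
  set m := ∫ x, x ^ 6 ∂(gaussianReal 0 (Real.toNNReal (σ ^ 2 / 2))) with hm
  have hm0 : 0 ≤ m := integral_nonneg fun x => by positivity
  refine ⟨16 * (1 ^ 3 + C ^ 3) + 256 * ((m + m) + (m + m) + (m + m)), by positivity,
    fun N hN g₁ g₂ B hB hBC => ?_⟩
  obtain ⟨iB, eB⟩ := integral_norm_cube_le hB hBC
  set Y : ℝ → Ω → ℝ := fun g ω => (∑ n ∈ Finset.range N, (rate N * osc (-(g * n))) * w n ω).re with hY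
  set Z : ℝ → Ω → ℝ := fun g ω =>
    (∑ n ∈ Finset.range N, (-Complex.I * (rate N * osc (-(g * n)))) * w n ω).re with hZ
  have mY : ∀ g, Measurable (Y g) := fun g => Complex.measurable_re.comp (hw.measurable_sum N _)
  have mZ : ∀ g, Measurable (Z g) := fun g => Complex.measurable_re.comp (hw.measurable_sum N _)
  have lY : ∀ g, P.map (Y g) = gaussianReal 0 (Real.toNNReal (σ ^ 2 / 2)) := fun g => by
    have := hw.map_re_unit_sum hN g (θ := 1) (by simp)
    simpa only [one_mul] using this
  have lZ : ∀ g, P.map (Z g) = gaussianReal 0 (Real.toNNReal (σ ^ 2 / 2)) := fun g =>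
    hw.map_re_unit_sum hN g (by simp)
  have iY := fun g => integrable_pow_of_map_gaussianReal (mY g) (lY g) 6
  have iZ := fun g => integrable_pow_of_map_gaussianReal (mZ g) (lZ g) 6
  have eY := fun g => integral_pow_of_map_gaussianReal (mY g) (lY g) 6
  have eZ := fun g => integral_pow_of_map_gaussianReal (mZ g) (lZ g) 6
  set a := g₁ + 1 / 2 / N
  set b := g₁ + -(1 / 2) / N
  have hS : (fun ω => noiseSize N (fun n => w n ω) g₁ g₂ (B ω)) = fun ω => 1 + ‖B ω‖ +
      ((Y a ω ^ 2 + Z a ω ^ 2) + (Y b ω ^ 2 + Z b ω ^ 2) + (Y g₂ ω ^ 2 + Z g₂ ω ^ 2)) := by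
    ext ω
    rw [noiseSize, mul_add, mul_add, natCast_mul_sq_norm_fourierCoeff,
      natCast_mul_sq_norm_fourierCoeff, natCast_mul_sq_norm_fourierCoeff]
  have hS' := fun ω => congrFun hS ω
  simp only [hS']
  have add : ∀ {f g : Ω → ℝ} {α β : ℝ}, Integrable f P ∧ ∫ ω, f ω ∂P = α →
      Integrable g P ∧ ∫ ω, g ω ∂P = β →
      Integrable (fun ω => f ω + g ω) P ∧ ∫ ω, (f ω + g ω) ∂P = α + β := fun hf hg =>
    ⟨hf.1.add hg.1, by rw [integral_add hf.1 hg.1, hf.2, hg.2]⟩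
  have smul : ∀ {f : Ω → ℝ} {α : ℝ} (r : ℝ), Integrable f P ∧ ∫ ω, f ω ∂P = α →
      Integrable (fun ω => r * f ω) P ∧ ∫ ω, r * f ω ∂P = r * α := fun r hf =>
    ⟨hf.1.const_mul r, by rw [integral_const_mul, hf.2]⟩
  have sY := fun g => And.intro (iY g) (eY g)
  have sZ := fun g => And.intro (iZ g) (eZ g)
  have s1 : Integrable (fun _ : Ω => (1 : ℝ) ^ 3) P ∧ ∫ _ : Ω, (1 : ℝ) ^ 3 ∂P = 1 ^ 3 :=
    ⟨integrable_const _, by simp⟩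
  obtain ⟨iH, eH⟩ := add (smul 16 (add s1 ⟨iB, rfl⟩)) (smul 256
    (add (add (add (sY a) (sZ a)) (add (sY b) (sZ b))) (add (sY g₂) (sZ g₂))))
  have hle : ∀ ω, (1 + ‖B ω‖ + ((Y a ω ^ 2 + Z a ω ^ 2) + (Y b ω ^ 2 + Z b ω ^ 2) +
      (Y g₂ ω ^ 2 + Z g₂ ω ^ 2))) ^ 3 ≤ 16 * (1 ^ 3 + ‖B ω‖ ^ 3) +
      256 * ((Y a ω ^ 6 + Z a ω ^ 6) + (Y b ω ^ 6 + Z b ω ^ 6) + (Y g₂ ω ^ 6 + Z g₂ ω ^ 6)) :=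
    fun ω => cube_sum_le zero_le_one (norm_nonneg _)
  have iS : Integrable (fun ω => (1 + ‖B ω‖ + ((Y a ω ^ 2 + Z a ω ^ 2) + (Y b ω ^ 2 + Z b ω ^ 2) +
      (Y g₂ ω ^ 2 + Z g₂ ω ^ 2))) ^ 3) P := by
    have ma := mY a; have mb := mY b; have mc := mY g₂
    have na := mZ a; have nb := mZ b; have nc := mZ g₂
    refine iH.mono' (by fun_prop) (Eventually.of_forall fun ω => ?_)
    rw [Real.norm_of_nonneg (by positivity)]
    exact hle ω
  refine ⟨iS, (integral_mono iS iH hle).trans ?_⟩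
  rw [eH]
  gcongr

end Noise

/-! ### Exact law of the first-order term -/

/-- Geometric sum of a nontrivial root of unity; N = 1 is excluded because the ratio would be 1. It
makes the exponentials at offsets ±1/(2N) orthogonal. -/
lemma sum_osc_div_eq_zero {N : ℕ} (hN : 2 ≤ N) : ∑ n ∈ Finset.range N, osc (1 / N * n) = 0 := by
  have hN' : (2 : ℝ) ≤ N := by exact_mod_cast hN
  have hN0 : (N : ℝ) ≠ 0 := by linarith
  have h1 : osc (1 / N) ≠ 1 := by
    refine osc_ne_one_of_abs_le ?_ (by positivity)
    rw [abs_of_nonneg (by positivity)]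
    exact one_div_le_one_div_of_le two_pos hN'
  simp only [osc_mul_natCast]
  rw [geom_sum_eq h1, ← osc_mul_natCast, one_div_mul_cancel hN0]
  have : osc 1 = 1 := by exact_mod_cast osc_intCast 1
  rw [this, sub_self, zero_div]

/-- Parseval's identity for two orthogonal exponentials. -/
lemma sum_sq_norm_two_tones {N : ℕ} (hN : 2 ≤ N) {g g' : ℝ} (hg : g - g' = 1 / N) (U V : ℂ) :
    ∑ n ∈ Finset.range N, ‖U * osc (-(g * n)) + V * osc (-(g' * n))‖ ^ 2 =
      N * (‖U‖ ^ 2 + ‖V‖ ^ 2) := by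
  have h1 : ∀ n : ℕ, ‖U * osc (-(g * n)) + V * osc (-(g' * n))‖ ^ 2 =
      ‖U‖ ^ 2 + ‖V‖ ^ 2 + 2 * (V * (starRingEnd ℂ) U * osc (1 / N * n)).re := fun n => by
    have h2 : osc (-(g' * n)) = osc (-(g * n)) * osc (1 / N * n) := by
      rw [← osc_add, ← hg]; congr 1; ring
    have h3 : U * osc (-(g * n)) + V * osc (-(g' * n)) =
        osc (-(g * n)) * (V * osc (1 / N * n) + U) := by rw [h2]; ring
    rw [h3, norm_mul, norm_osc, one_mul, Complex.sq_norm, Complex.normSq_add, ← Complex.sq_norm,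
      ← Complex.sq_norm, norm_mul, norm_osc, mul_one]
    rw [show V * osc (1 / N * n) * (starRingEnd ℂ) U = V * (starRingEnd ℂ) U * osc (1 / N * n) by ring]
    ring
  simp only [h1]
  rw [Finset.sum_add_distrib, ← Finset.mul_sum, ← Complex.re_sum, ← Finset.mul_sum,
    sum_osc_div_eq_zero hN]
  simp
  ring

lemma linTerm_fourierCoeff (N : ℕ) (A : ℂ) (d : ℝ) (x : ℕ → ℂ) (g g' : ℝ) :
    linTerm A d (fourierCoeff N x g) (fourierCoeff N x g') = ∑ n ∈ Finset.range N,
      (1 / N * (-(Real.pi * Complex.I) * (1 - 2 * d) * invSlope A d * osc (-(g * n))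
        + -(Real.pi * Complex.I) * (1 + 2 * d) * invSlope A d * osc (-(g' * n)))) * x n := by
  rw [linTerm, fourierCoeff_eq_sum, fourierCoeff_eq_sum, Finset.mul_sum, Finset.mul_sum,
    ← Finset.sum_add_distrib]
  exact Finset.sum_congr rfl fun n _ => by ring

lemma invSlope_mul_fourierCoeff_sub (N : ℕ) (A : ℂ) (d : ℝ) (x : ℕ → ℂ) (g g' : ℝ) :
    invSlope A d * (fourierCoeff N x g - fourierCoeff N x g') = ∑ n ∈ Finset.range N,
      (1 / N * invSlope A d * (osc (-(g * n)) - osc (-(g' * n)))) * x n := by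
  rw [fourierCoeff_eq_sum, fourierCoeff_eq_sum, ← Finset.sum_sub_distrib, Finset.mul_sum]
  exact Finset.sum_congr rfl fun n _ => by ring

lemma norm_invSlope (A : ℂ) (d : ℝ) : ‖invSlope A d‖ = Real.pi * |kappa d| / ‖A‖ := by
  simp only [invSlope, norm_div, norm_neg, norm_mul, Complex.norm_I, norm_osc, mul_one,
    Complex.norm_real, Real.norm_eq_abs, abs_of_pos Real.pi_pos]

lemma asympVar_pos {N : ℕ} (hN : 1 ≤ N) {ρ δ ν : ℝ} (hρ : 0 < ρ) (hd : |δ - ν| ≤ 1) :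
    0 < asympVar N ρ δ ν := by
  have hk : kappa (δ - ν) ≠ 0 := by
    intro h
    have := one_le_abs_kappa hd
    rw [h] at this; norm_num at this
  have : (0 : ℝ) < N := by exact_mod_cast hN
  unfold asympVar
  have hk2 : 0 < kappa (δ - ν) ^ 2 := by positivity
  positivity

/-- As π²κ² ≥ 1/4, the variance is at least 1/(16ρN³). This uniform lower bound permits division of
the remainder by the standard deviation. -/
lemma rate_cube_le_sqrt_asympVar {N : ℕ} (hN : 1 ≤ N) {ρ δ ν : ℝ} (hρ : 0 < ρ) (hd : |δ - ν| ≤ 1) :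
    rate N ^ 3 ≤ 4 * √ρ * √(asympVar N ρ δ ν) := by
  have hN' : (0 : ℝ) < N := by exact_mod_cast hN
  refine abs_le_of_sq_le_sq' ?_ (by positivity) |>.2
  rw [mul_pow, mul_pow, Real.sq_sqrt hρ.le, Real.sq_sqrt (asympVar_pos hN hρ hd).le, ← pow_mul,
    mul_comm 3 2, pow_mul, rate_sq, asympVar]
  have h1 : 1 ≤ (2 * Real.pi * |kappa (δ - ν)|) ^ 2 := one_le_pow₀ (one_le_abs_kappa hd)
  rw [mul_pow, mul_pow, sq_abs] at h1
  have h2 : 4 ^ 2 * ρ * (Real.pi ^ 2 * kappa (δ - ν) ^ 2 * (1 + 4 * (δ - ν) ^ 2) / (4 * ρ * N ^ 3)) =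
      (2 ^ 2 * Real.pi ^ 2 * kappa (δ - ν) ^ 2 * (1 + 4 * (δ - ν) ^ 2)) / N ^ 3 := by
    field_simp; ring
  rw [h2, one_div, inv_pow, ← one_div]
  gcongr
  nlinarith [sq_nonneg (δ - ν)]

section Noise

variable {Ω : Type*} [MeasurableSpace Ω] {P : Measure Ω} [IsProbabilityMeasure P] {w : ℕ → Ω → ℂ}
  {σ : ℝ}

/-- The normalised first-order term is exactly standard Gaussian. -/
lemma IsComplexWhiteGaussian.map_linTerm (hw : IsComplexWhiteGaussian P w σ) (hσ : 0 < σ) {A : ℂ}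
    (hA : A ≠ 0) {N : ℕ} (hN : 2 ≤ N) {δ ν : ℝ} (hd : |δ - ν| ≤ 1) (g : ℝ) :
    P.map (fun ω => -(1 / (2 * Real.pi) * ((rate N : ℂ) ^ 2 * linTerm A (δ - ν)
      (fourierCoeff N (fun n => w n ω) (g + 1 / 2 / N))
      (fourierCoeff N (fun n => w n ω) (g + -(1 / 2) / N))).im)
      / √(asympVar N (‖A‖ ^ 2 / σ ^ 2) δ ν)) = gaussianReal 0 1 := by
  have hA' : 0 < ‖A‖ := norm_pos_iff.2 hA
  have hN' : (0 : ℝ) < N := by exact_mod_cast (by omega : 0 < N)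
  have hv := asympVar_pos (N := N) (by omega) (ρ := ‖A‖ ^ 2 / σ ^ 2) (by positivity) hd
  set v := asympVar N (‖A‖ ^ 2 / σ ^ 2) δ ν with hv_def
  set d := δ - ν with hd_def
  set U : ℂ := -(Real.pi * Complex.I) * (1 - 2 * d) * invSlope A d with hU
  set V : ℂ := -(Real.pi * Complex.I) * (1 + 2 * d) * invSlope A d with hV
  set c : ℕ → ℂ := fun n => ((1 / (2 * Real.pi) * (rate N ^ 2 / √v) * (1 / N) : ℝ) : ℂ) * Complex.I *
    (U * osc (-((g + 1 / 2 / N) * n)) + V * osc (-((g + -(1 / 2) / N) * n))) with hc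
  have hfun : (fun ω => -(1 / (2 * Real.pi) * ((rate N : ℂ) ^ 2 * linTerm A d
      (fourierCoeff N (fun n => w n ω) (g + 1 / 2 / N))
      (fourierCoeff N (fun n => w n ω) (g + -(1 / 2) / N))).im) / √v) =
      fun ω => (∑ n ∈ Finset.range N, c n * w n ω).re := by
    ext ω
    rw [linTerm_fourierCoeff]
    simp only [← hU, ← hV]
    have h1 : ∑ n ∈ Finset.range N, c n * w n ω =
        ((1 / (2 * Real.pi) * (rate N ^ 2 / √v) : ℝ) : ℂ) * (Complex.I * ∑ n ∈ Finset.range N,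
          (1 / N * (U * osc (-((g + 1 / 2 / N) * n)) + V * osc (-((g + -(1 / 2) / N) * n)))) * w n ω) := by
      rw [Finset.mul_sum, Finset.mul_sum]
      refine Finset.sum_congr rfl fun n _ => ?_
      simp only [hc]; push_cast; ring
    rw [h1, Complex.re_ofReal_mul, Complex.I_mul_re, ← Complex.ofReal_pow, Complex.im_ofReal_mul]
    ring
  rw [hfun, hw.map_re_sum]
  congr 1
  have hcn : ∀ n, ‖c n‖ ^ 2 = (1 / (2 * Real.pi) * (rate N ^ 2 / √v) * (1 / N)) ^ 2 *
      ‖U * osc (-((g + 1 / 2 / N) * n)) + V * osc (-((g + -(1 / 2) / N) * n))‖ ^ 2 := fun n => by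
    simp only [hc]
    rw [norm_mul, norm_mul, Complex.norm_I, mul_one, mul_pow, Complex.norm_real, Real.norm_eq_abs,
      sq_abs]
  simp only [hcn]
  rw [← Finset.mul_sum, sum_sq_norm_two_tones hN (by field_simp; ring)]
  have hUn : ‖U‖ ^ 2 = Real.pi ^ 2 * (1 - 2 * d) ^ 2 * (Real.pi * |kappa d| / ‖A‖) ^ 2 := by
    rw [hU, norm_mul, norm_mul, norm_neg, norm_mul, Complex.norm_I, mul_one, norm_invSlope,
      Complex.norm_real, mul_pow, mul_pow, Real.norm_eq_abs, sq_abs]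
    rw [show (1 - 2 * d : ℂ) = ((1 - 2 * d : ℝ) : ℂ) by push_cast; ring, Complex.norm_real,
      Real.norm_eq_abs, sq_abs]
  have hVn : ‖V‖ ^ 2 = Real.pi ^ 2 * (1 + 2 * d) ^ 2 * (Real.pi * |kappa d| / ‖A‖) ^ 2 := by
    rw [hV, norm_mul, norm_mul, norm_neg, norm_mul, Complex.norm_I, mul_one, norm_invSlope,
      Complex.norm_real, mul_pow, mul_pow, Real.norm_eq_abs, sq_abs]
    rw [show (1 + 2 * d : ℂ) = ((1 + 2 * d : ℝ) : ℂ) by push_cast; ring, Complex.norm_real,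
      Real.norm_eq_abs, sq_abs]
  -- The weights combine through (1 - 2d)² + (1 + 2d)² = 2(1 + 4d²), the source of that factor in
  -- the variance.
  have hone : σ ^ 2 / 2 * ((1 / (2 * Real.pi) * (rate N ^ 2 / √v) * (1 / N)) ^ 2 *
      (N * (‖U‖ ^ 2 + ‖V‖ ^ 2))) = 1 := by
    rw [hUn, hVn, rate_sq, mul_pow, mul_pow, div_pow (1 / (N : ℝ)), Real.sq_sqrt hv.le,
      div_pow _ ‖A‖, mul_pow Real.pi, sq_abs]
    have hk : σ ^ 2 * (Real.pi ^ 2 * kappa d ^ 2 * (1 + 4 * d ^ 2)) = v * (4 * ‖A‖ ^ 2 * N ^ 3) := by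
      rw [hv_def, asympVar, ← hd_def]
      field_simp
    have hpi := Real.pi_pos
    field_simp
    linear_combination 2 * hk
  rw [hone, Real.toNNReal_one]

end Noise

/-! ### Measurability and modes of convergence -/

lemma measurable_freqEst {Ω : Type*} [MeasurableSpace Ω] {x : ℕ → Ω → ℂ} {B : Ω → ℂ}
    (hx : ∀ n, Measurable (x n)) (hB : Measurable B) (N : ℕ) (m₁ m₂ : ℤ) (ν₁ ν₂ : ℝ) :
    Measurable (fun ω => freqEst N (fun n => x n ω) m₁ m₂ ν₁ ν₂ (B ω)) := by
  have hF : ∀ {y : ℕ → Ω → ℂ}, (∀ n, Measurable (y n)) → ∀ g,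
      Measurable (fun ω => fourierCoeff N (fun n => y n ω) g) := fun hy g =>
    (Finset.measurable_sum _ fun n _ => (hy n).mul_const _).const_mul _
  have hT : ∀ {A : Ω → ℂ}, Measurable A → ∀ (g : ℝ) (n : ℕ), Measurable (fun ω => tone (A ω) g n) :=
    fun hA g n => hA.mul_const _
  have hA : Measurable (fun ω => ampEst N (fun n => x n ω) (freq N m₂ ν₂) (B ω) (freq N m₁ ν₁)) :=
    hF (y := fun n ω => x n ω - tone (B ω) (freq N m₁ ν₁) n) (fun n => (hx n).sub (hT hB _ n)) _
  have hL : ∀ r, Measurable (fun ω => leakageFreeCoeff N (fun n => x n ω) (freq N m₁ ν₁)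
      (ampEst N (fun n => x n ω) (freq N m₂ ν₂) (B ω) (freq N m₁ ν₁)) (freq N m₂ ν₂) r) := fun r =>
    (hF hx _).sub (hF (y := fun n ω => tone (ampEst N (fun n => x n ω) (freq N m₂ ν₂) (B ω)
      (freq N m₁ ν₁)) (freq N m₂ ν₂) n) (fun n => hT hA _ n) _)
  have h1 := hL (1 / 2)
  have h2 := hL (-(1 / 2))
  simp only [freqEst, residualEst, interp]
  refine (measurable_const.add (measurable_const.add (Measurable.const_mul ?_ _))).div_const _
  refine Complex.measurable_im.comp (Complex.measurable_log.comp ?_)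
  exact measurable_const.sub (((((h1.add h2).div (h1.sub h2)).const_mul _).const_mul _).mul_const _)

/-- At fixed N the estimate is bounded because the principal argument is; integrability then needs
no moment of the amplitude estimate. -/
lemma abs_freqEst_le (N : ℕ) (x : ℕ → ℂ) (m₁ m₂ : ℤ) (ν₁ ν₂ : ℝ) (B : ℂ) :
    |freqEst N x m₁ m₂ ν₁ ν₂ B| ≤ (|(m₁ : ℝ)| + (|ν₁| + N / 2)) / N := by
  simp only [freqEst, freq]
  rw [abs_div, Nat.abs_cast]
  gcongr
  refine (abs_add_le _ _).trans ?_
  gcongr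
  refine (abs_add_le _ _).trans ?_
  gcongr
  exact abs_residualEst_le _ _ _

lemma tendsto_rate : Tendsto rate atTop (𝓝 0) :=
  tendsto_inv_atTop_zero.comp (Real.tendsto_sqrt_atTop.comp tendsto_natCast_atTop_atTop)

/-- A sequence which is eventually equal in law to the limit converges in distribution. -/
lemma tendstoInDistribution_of_eventually_map_eq {Ω Ω' : Type*} [MeasurableSpace Ω]
    [MeasurableSpace Ω'] {P : Measure Ω} [IsProbabilityMeasure P] {P' : Measure Ω'}
    [IsProbabilityMeasure P'] {X : ℕ → Ω → ℝ} {Z : Ω' → ℝ} (hX : ∀ N, Measurable (X N))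
    (hZ : Measurable Z) (h : ∀ᶠ N in atTop, P.map (X N) = P'.map Z) :
    TendstoInDistribution X atTop Z (fun _ => P) P' where
  forall_aemeasurable N := (hX N).aemeasurable
  aemeasurable_limit := hZ.aemeasurable
  tendsto := by
    refine tendsto_const_nhds.congr' ?_
    filter_upwards [h] with N hN
    exact Subtype.ext hN.symm

/-- The bound gives E|X| ≤ aK → 0, and convergence in L¹ implies convergence in measure. -/
lemma tendstoInMeasure_zero_of_le {Ω : Type*} [MeasurableSpace Ω] {P : Measure Ω}
    {X : ℕ → Ω → ℝ} (hX : ∀ N, Measurable (X N)) {S : ℕ → Ω → ℝ} {a : ℕ → ℝ} (ha0 : ∀ N, 0 ≤ a N)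
    (ha : Tendsto a atTop (𝓝 0)) {K : ℝ}
    (h : ∀ᶠ N in atTop, (∀ ω, |X N ω| ≤ a N * S N ω) ∧ Integrable (S N) P ∧ ∫ ω, S N ω ∂P ≤ K) :
    TendstoInMeasure P X atTop 0 := by
  refine tendstoInMeasure_of_tendsto_eLpNorm (p := 1) one_ne_zero
    (fun N => (hX N).aestronglyMeasurable) aestronglyMeasurable_const ?_
  have hlim : Tendsto (fun N => ENNReal.ofReal (a N * K)) atTop (𝓝 0) := by
    have := ENNReal.tendsto_ofReal (ha.mul_const K)
    simpa using this
  refine tendsto_of_tendsto_of_tendsto_of_le_of_le' tendsto_const_nhds hlim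
    (Eventually.of_forall fun _ => zero_le) ?_
  filter_upwards [h] with N ⟨h1, h2, h3⟩
  rw [sub_zero, eLpNorm_one_eq_lintegral_enorm]
  have h4 : ∀ ω, ‖X N ω‖ₑ ≤ ENNReal.ofReal (a N * S N ω) := fun ω => by
    rw [← ofReal_norm]
    exact ENNReal.ofReal_le_ofReal (h1 ω)
  refine (lintegral_mono h4).trans ?_
  rw [← ofReal_integral_eq_lintegral_ofReal (h2.const_mul _)
    (Eventually.of_forall fun ω => (abs_nonneg _).trans (h1 ω)), integral_const_mul]
  exact ENNReal.ofReal_le_ofReal (mul_le_mul_of_nonneg_left h3 (ha0 N))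

lemma norm_linTerm_le (A : ℂ) {d : ℝ} (hd : |d| ≤ 1) {a b : ℂ} {c : ℝ} (ha : ‖a‖ ≤ c) (hb : ‖b‖ ≤ c) :
    ‖linTerm A d a b‖ ≤ 4 * 3 * (3 / ‖A‖) * c + 4 * 3 * (3 / ‖A‖) * c := by
  have h2 : ‖(2 * d : ℂ)‖ ≤ 2 := by
    rw [norm_mul, Complex.norm_real, Complex.norm_ofNat, Real.norm_eq_abs]; linarith
  have h3 : ‖(1 - 2 * d : ℂ)‖ ≤ 3 := (norm_sub_le _ _).trans (by rw [norm_one]; linarith)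
  have h4 : ‖(1 + 2 * d : ℂ)‖ ≤ 3 := (norm_add_le _ _).trans (by rw [norm_one]; linarith)
  have h5 := norm_invSlope_le A hd
  have hpi := Real.pi_le_four
  unfold linTerm
  refine (norm_add_le _ _).trans ?_
  simp only [norm_mul, norm_neg, Complex.norm_I, mul_one, Complex.norm_real,
    Real.norm_of_nonneg Real.pi_pos.le]
  gcongr

end FreqEst

end

/-! ### Normality, mean and vanishing of the bias -/

open FreqEst MeasureTheory ProbabilityTheory Filter Topology in
theorem lemma1
    {Ω : Type*} [MeasurableSpace Ω] (P : MeasureTheory.Measure Ω)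
    [MeasureTheory.IsProbabilityMeasure P]
    -- the noise
    (w : ℕ → Ω → ℂ) (σ : ℝ) (hσ : 0 < σ) (hw : FreqEst.IsComplexWhiteGaussian P w σ)
    -- amplitudes, true bins, true residuals; these give the true frequencies for each length `N`
    (A₁ A₂ : ℂ) (hA₁ : A₁ ≠ 0) (m₁ m₂ : ℕ → ℤ) (δ₁ δ₂ : ℕ → ℝ)
    (hδ₁ : ∀ N, |δ₁ N| ≤ 1 / 2) (hδ₂ : ∀ N, |δ₂ N| ≤ 1 / 2)
    (f₁ f₂ : ℕ → ℝ)
    (hf₁ : ∀ N, f₁ N = FreqEst.freq N (m₁ N) (δ₁ N))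
    (hf₂ : ∀ N, f₂ N = FreqEst.freq N (m₂ N) (δ₂ N))
    -- the frequencies, as points of the circle `ℝ / ℤ`, are separated independently of `N`
    (Δ : ℝ) (hΔ : 0 < Δ) (hsep : ∀ N, 1 ≤ N → ∀ k : ℤ, Δ ≤ |f₁ N - f₂ N - k|)
    -- the current estimates of the residuals and of the first amplitude
    (ν₁ ν₂ : ℕ → ℝ) (hν₁ : ∀ N, |ν₁ N| ≤ 1 / 2) (hν₂ : ∀ N, |ν₂ N| ≤ 1 / 2)
    (B₁ : ℕ → Ω → ℂ) (hB₁ : ∀ N, Measurable (B₁ N))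
    (hB₁_bdd : ∃ C : NNReal, ∀ N, MeasureTheory.eLpNorm (B₁ N) 3 P ≤ C)
    -- the new estimate of the first frequency, its bias and its variance
    (fhat : ℕ → Ω → ℝ)
    (hfhat : ∀ N ω, fhat N ω =
      FreqEst.freqEst N (FreqEst.signal A₁ A₂ (f₁ N) (f₂ N) (fun n => w n ω))
        (m₁ N) (m₂ N) (ν₁ N) (ν₂ N) (B₁ N ω))
    (μ v : ℕ → ℝ)
    (hμ : ∀ N, μ N = FreqEst.bias N A₁ A₂ (m₂ N - m₁ N) (δ₁ N) (δ₂ N) (ν₁ N) (ν₂ N))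
    (hv : ∀ N, v N = FreqEst.asympVar N (‖A₁‖ ^ 2 / σ ^ 2) (δ₁ N) (ν₁ N)) :
    -- asymptotic normality
    MeasureTheory.TendstoInDistribution
      (fun N ω => (fhat N ω - (f₁ N + μ N)) / Real.sqrt (v N)) Filter.atTop
      (fun x : ℝ => x) (fun _ => P) (ProbabilityTheory.gaussianReal 0 1) ∧
    -- `μ` is the mean error up to `o(N⁻²)`
    (∀ N, MeasureTheory.Integrable (fhat N) P) ∧
    Filter.Tendsto (fun N : ℕ => (N : ℝ) ^ 2 * ((∫ ω, fhat N ω ∂P) - (f₁ N + μ N)))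
      Filter.atTop (nhds 0) ∧
    -- the bias vanishes at the true residuals
    (∀ N, 1 ≤ N → ν₁ N = δ₁ N → ν₂ N = δ₂ N → μ N = 0) := by
  obtain ⟨C, hC, hexp⟩ := freqEst_expansion w A₂ hA₁ m₁ m₂ hδ₁ hδ₂ hν₁ hν₂ hΔ
    (fun N hN k => by rw [← hf₁, ← hf₂]; exact hsep N hN k) B₁
  obtain ⟨CB, hCB⟩ := hB₁_bdd
  obtain ⟨K, hK, hmom⟩ := hw.integral_noiseSize_le CB
  have hA' : 0 < ‖A₁‖ := norm_pos_iff.2 hA₁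
  set ρ := ‖A₁‖ ^ 2 / σ ^ 2 with hρ_def
  have hρ : 0 < ρ := by positivity
  have hd : ∀ N, |δ₁ N - ν₁ N| ≤ 1 := fun N => by
    have h1 := abs_le.1 (hδ₁ N)
    have h2 := abs_le.1 (hν₁ N)
    exact abs_le.2 ⟨by linarith, by linarith⟩
  set S : ℕ → Ω → ℝ := fun N ω => noiseSize N (fun n => w n ω) (freq N (m₁ N) (ν₁ N))
    (freq N (m₂ N) (ν₂ N)) (B₁ N ω) with hS
  have hS1 : ∀ N ω, 1 ≤ S N ω := fun N ω => one_le_noiseSize _ _ _ _ _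
  set Wp : ℕ → Ω → ℂ := fun N ω =>
    fourierCoeff N (fun n => w n ω) (freq N (m₁ N) (ν₁ N) + 1 / 2 / N) with hWp
  set Wm : ℕ → Ω → ℂ := fun N ω =>
    fourierCoeff N (fun n => w n ω) (freq N (m₁ N) (ν₁ N) + -(1 / 2) / N) with hWm
  set X : ℕ → Ω → ℂ := fun N ω => linTerm A₁ (δ₁ N - ν₁ N) (Wp N ω) (Wm N ω) with hX
  set Y : ℕ → Ω → ℂ := fun N ω => invSlope A₁ (δ₁ N - ν₁ N) * (Wp N ω - Wm N ω) with hY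
  set L : ℕ → Ω → ℝ := fun N ω => 1 / (2 * Real.pi) * ((rate N : ℂ) ^ 2 * X N ω).im with hL
  set Q : ℕ → Ω → ℝ := fun N ω => 1 / (2 * Real.pi) * ((rate N : ℂ) ^ 2 * (X N ω * Y N ω)).im with hQ
  have him : ∀ (N : ℕ) (z : ℂ), ((rate N : ℂ) ^ 2 * z).im = rate N ^ 2 * z.im := fun N z => by
    rw [← Complex.ofReal_pow, Complex.im_ofReal_mul]
  have hrem : ∀ᶠ N in atTop, ∀ ω,
      |fhat N ω - (f₁ N + μ N) + L N ω - Q N ω| ≤ C * (rate N ^ 5 * S N ω ^ 3) := by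
    filter_upwards [hexp] with N hN ω
    have := hN ω
    rw [hfhat, hμ, hf₁, hf₂]
    exact this
  have hXL : ∀ N, Integrable (L N) P ∧ ∫ ω, L N ω ∂P = 0 := fun N => by
    simp only [hL, him, hX, hWp, hWm, linTerm_fourierCoeff]
    obtain ⟨h1, h2⟩ := hw.integral_im N fun n => 1 / N *
      (-(Real.pi * Complex.I) * (1 - 2 * ((δ₁ N - ν₁ N : ℝ) : ℂ)) * invSlope A₁ (δ₁ N - ν₁ N)
        * osc (-((freq N (m₁ N) (ν₁ N) + 1 / 2 / N) * n))
      + -(Real.pi * Complex.I) * (1 + 2 * ((δ₁ N - ν₁ N : ℝ) : ℂ)) * invSlope A₁ (δ₁ N - ν₁ N)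
        * osc (-((freq N (m₁ N) (ν₁ N) + -(1 / 2) / N) * n)))
    exact ⟨(h1.const_mul _).const_mul _, by rw [integral_const_mul, integral_const_mul, h2]; simp⟩
  -- `X` and `Y` are both complex-linear in the noise, without conjugates, so circularity applies to
  -- their product.
  have hXQ : ∀ N, Integrable (Q N) P ∧ ∫ ω, Q N ω ∂P = 0 := fun N => by
    simp only [hQ, him, hX, hY, hWp, hWm, linTerm_fourierCoeff, invSlope_mul_fourierCoeff_sub]
    obtain ⟨h1, h2⟩ := hw.integral_im_mul N (fun n => 1 / N *
      (-(Real.pi * Complex.I) * (1 - 2 * ((δ₁ N - ν₁ N : ℝ) : ℂ)) * invSlope A₁ (δ₁ N - ν₁ N)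
        * osc (-((freq N (m₁ N) (ν₁ N) + 1 / 2 / N) * n))
      + -(Real.pi * Complex.I) * (1 + 2 * ((δ₁ N - ν₁ N : ℝ) : ℂ)) * invSlope A₁ (δ₁ N - ν₁ N)
        * osc (-((freq N (m₁ N) (ν₁ N) + -(1 / 2) / N) * n))))
      (fun n => 1 / N * invSlope A₁ (δ₁ N - ν₁ N) *
        (osc (-((freq N (m₁ N) (ν₁ N) + 1 / 2 / N) * n))
          - osc (-((freq N (m₁ N) (ν₁ N) + -(1 / 2) / N) * n))))
    exact ⟨(h1.const_mul _).const_mul _, by rw [integral_const_mul, integral_const_mul, h2]; simp⟩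
  have hfm : ∀ N, Measurable (fhat N) := fun N => by
    have h1 : fhat N = fun ω => freqEst N (fun n => signal A₁ A₂ (f₁ N) (f₂ N) (fun n => w n ω) n)
        (m₁ N) (m₂ N) (ν₁ N) (ν₂ N) (B₁ N ω) := funext fun ω => hfhat N ω
    rw [h1]
    exact measurable_freqEst (fun n => (hw.measurable n).const_add _) (hB₁ N) _ _ _ _ _
  have hfi : ∀ N, Integrable (fhat N) P := fun N =>
    Integrable.of_bound (hfm N).aestronglyMeasurable _ (Eventually.of_forall fun ω => by
      rw [hfhat, Real.norm_eq_abs]; exact abs_freqEst_le _ _ _ _ _ _ _)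
  have hWm' : ∀ N g, Measurable (fun ω => fourierCoeff N (fun n => w n ω) g) := fun N g => by
    simp only [fourierCoeff_eq_sum]; exact hw.measurable_sum N _
  have hLm : ∀ N, Measurable (L N) := fun N => by
    simp only [hL, hX, linTerm]
    exact (Complex.measurable_im.comp ((((hWm' N _).const_mul _).add
      ((hWm' N _).const_mul _)).const_mul _)).const_mul _
  -- the quadratic term is of smaller order
  have hQb : ∀ N, 1 ≤ N → ∀ ω, |Q N ω| ≤
      (4 * 3 * (3 / ‖A₁‖) * 2) * (3 / ‖A₁‖ * 2) * (rate N ^ 4 * S N ω ^ 3) := fun N hN ω => by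
    have hq0 := rate_nonneg N
    have hs1 := hS1 N ω
    obtain ⟨h1, h2, -⟩ := sq_norm_fourierCoeff_le N (fun n => w n ω) (freq N (m₁ N) (ν₁ N))
      (freq N (m₂ N) (ν₂ N)) (B₁ N ω)
    have hle : ∀ z : ℂ, ‖z‖ ^ 2 ≤ rate N ^ 2 * S N ω → ‖z‖ ≤ rate N * S N ω := fun z hz => by
      refine abs_le_of_sq_le_sq' (hz.trans ?_) (by positivity) |>.2
      rw [mul_pow]
      exact mul_le_mul_of_nonneg_left (le_self_pow₀ hs1 two_ne_zero) (by positivity)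
    have hp : ‖Wp N ω‖ ≤ rate N * S N ω := hle _ h1
    have hm : ‖Wm N ω‖ ≤ rate N * S N ω := hle _ h2
    have hXb : ‖X N ω‖ ≤ 4 * 3 * (3 / ‖A₁‖) * 2 * (rate N * S N ω) :=
      (norm_linTerm_le A₁ (hd N) hp hm).trans (le_of_eq (by ring))
    have hYb : ‖Y N ω‖ ≤ 3 / ‖A₁‖ * 2 * (rate N * S N ω) := by
      simp only [hY]
      rw [norm_mul, mul_assoc]
      gcongr
      · exact norm_invSlope_le A₁ (hd N)
      · exact (norm_sub_le _ _).trans (by linarith)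
    have hpi : 1 / (2 * Real.pi) ≤ 1 := by
      rw [div_le_one (by positivity)]; linarith [Real.pi_gt_three]
    simp only [hQ, him]
    rw [abs_mul, abs_mul, abs_of_nonneg (by positivity : 0 ≤ 1 / (2 * Real.pi)),
      abs_of_nonneg (by positivity : 0 ≤ rate N ^ 2)]
    calc 1 / (2 * Real.pi) * (rate N ^ 2 * |(X N ω * Y N ω).im|)
        ≤ 1 * (rate N ^ 2 * ((4 * 3 * (3 / ‖A₁‖) * 2 * (rate N * S N ω)) *
          (3 / ‖A₁‖ * 2 * (rate N * S N ω)))) := by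
          gcongr
          refine (Complex.abs_im_le_norm _).trans ?_
          rw [norm_mul]
          gcongr
      _ = (4 * 3 * (3 / ‖A₁‖) * 2) * (3 / ‖A₁‖ * 2) * (rate N ^ 4 * S N ω ^ 2) := by ring
      _ ≤ _ := by gcongr; norm_num
  set C' := (4 * 3 * (3 / ‖A₁‖) * 2) * (3 / ‖A₁‖ * 2) with hC'
  have hC'0 : 0 ≤ C' := by positivity
  refine ⟨?_, hfi, ?_, ?_⟩
  · -- asymptotic normality
    have hlaw : TendstoInDistribution (fun N ω => -L N ω / √(v N)) atTop (fun x : ℝ => x)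
        (fun _ => P) (gaussianReal 0 1) := by
      refine tendstoInDistribution_of_eventually_map_eq (fun N => (hLm N).neg.div_const _)
        measurable_id ?_
      filter_upwards [eventually_ge_atTop 2] with N hN
      rw [hv]
      exact (hw.map_linTerm hσ hA₁ hN (hd N) _).trans Measure.map_id.symm
    have hYm : ∀ N, Measurable (fun ω => (fhat N ω - (f₁ N + μ N)) / √(v N)) := fun N =>
      ((hfm N).sub_const _).div_const _
    -- Slutsky: the normalised estimate differs from the exactly Gaussian variable by a term that
    -- tends to 0 in measure.
    refine tendstoInDistribution_of_tendstoInMeasure_sub _ _ hlaw ?_ fun N => (hYm N).aemeasurable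
    refine tendstoInMeasure_zero_of_le (S := fun N ω => S N ω ^ 3)
      (a := fun N => 4 * √ρ * (C + C') * rate N) (K := K)
      (fun N => (hYm N).sub ((hLm N).neg.div_const _))
      (fun N => mul_nonneg (by positivity) (rate_nonneg N)) ?_ ?_
    · simpa using tendsto_rate.const_mul (4 * √ρ * (C + C'))
    · filter_upwards [hrem, eventually_ge_atTop 1] with N hN hN1
      refine ⟨fun ω => ?_, hmom N hN1 _ _ _ (hB₁ N) (hCB N)⟩
      have hvp : 0 < √(v N) := by rw [hv]; exact Real.sqrt_pos.2 (asympVar_pos hN1 hρ (hd N))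
      have hrv : rate N ^ 3 ≤ 4 * √ρ * √(v N) := by
        rw [hv]; exact rate_cube_le_sqrt_asympVar hN1 hρ (hd N)
      have hq0 := rate_nonneg N
      have hs1 := hS1 N ω
      have e1 : ((fun N ω => (fhat N ω - (f₁ N + μ N)) / √(v N)) - fun N ω => -L N ω / √(v N)) N ω =
          ((fhat N ω - (f₁ N + μ N) + L N ω - Q N ω) + Q N ω) / √(v N) := by
        simp only [Pi.sub_apply]; ring
      rw [e1, abs_div, abs_of_pos hvp, div_le_iff₀ hvp]
      calc _ ≤ C * (rate N ^ 5 * S N ω ^ 3) + C' * (rate N ^ 4 * S N ω ^ 3) :=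
            (abs_add_le _ _).trans (add_le_add (hN ω) (hQb N hN1 ω))
        _ ≤ C * (rate N ^ 4 * S N ω ^ 3) + C' * (rate N ^ 4 * S N ω ^ 3) := by
            -- For normality the remainder may be weakened from q⁵ to the order q⁴ of the quadratic
            -- term; after division by the standard deviation a factor q is left.
            gcongr C * (?_ * _) + _
            exact pow_le_pow_of_le_one hq0 (rate_le_one N) (by norm_num)
        _ = (C + C') * rate N * S N ω ^ 3 * rate N ^ 3 := by ring
        _ ≤ (C + C') * rate N * S N ω ^ 3 * (4 * √ρ * √(v N)) := by gcongr
        _ = _ := by ring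
  · -- the mean
    refine squeeze_zero_norm' (a := fun N => C * K * rate N) ?_ (by
      simpa using tendsto_rate.const_mul (C * K))
    filter_upwards [hrem, eventually_ge_atTop 1] with N hN hN1
    obtain ⟨iS, eS⟩ := hmom N hN1 (freq N (m₁ N) (ν₁ N)) (freq N (m₂ N) (ν₂ N)) _ (hB₁ N) (hCB N)
    have hN' : (N : ℝ) ≠ 0 := by exact_mod_cast (by omega : N ≠ 0)
    have hq0 := rate_nonneg N
    -- Adding `L` and subtracting `Q` does not change the mean, so only the O(q⁵) remainder is
    -- integrated.
    have e1 : (∫ ω, fhat N ω ∂P) - (f₁ N + μ N) =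
        ∫ ω, (fhat N ω - (f₁ N + μ N) + L N ω - Q N ω) ∂P := by
      have h1 : Integrable (fun ω => fhat N ω - (f₁ N + μ N)) P := (hfi N).sub (integrable_const _)
      have h2 : Integrable (fun ω => fhat N ω - (f₁ N + μ N) + L N ω) P := h1.add (hXL N).1
      rw [integral_sub h2 (hXQ N).1, integral_add h1 (hXL N).1,
        integral_sub (hfi N) (integrable_const _), (hXL N).2, (hXQ N).2]
      simp
    have e2 : ‖∫ ω, (fhat N ω - (f₁ N + μ N) + L N ω - Q N ω) ∂P‖ ≤ C * (rate N ^ 5 * K) := by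
      refine (norm_integral_le_of_norm_le ((iS.const_mul (rate N ^ 5)).const_mul C)
        (Eventually.of_forall hN)).trans ?_
      rw [integral_const_mul, integral_const_mul]
      gcongr
    rw [e1, norm_mul, Real.norm_of_nonneg (by positivity)]
    have hq4 : (N : ℝ) ^ 2 * rate N ^ 4 = 1 := by
      rw [show rate N ^ 4 = (rate N ^ 2) ^ 2 by ring, rate_sq]; field_simp
    calc (N : ℝ) ^ 2 * ‖∫ ω, (fhat N ω - (f₁ N + μ N) + L N ω - Q N ω) ∂P‖
        ≤ (N : ℝ) ^ 2 * (C * (rate N ^ 5 * K)) := by gcongr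
      _ = C * K * rate N * ((N : ℝ) ^ 2 * rate N ^ 4) := by ring
      _ = _ := by rw [hq4, mul_one]
  · -- vanishing bias
    intro N _ h1 h2
    rw [hμ, h1, h2]
    -- At the true residuals `gain` takes its value 1 at 0, and the two terms of each β coincide.
    simp [bias, FreqEst.beta, gain]
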